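/- Let $n\ge 1$ be an integer and let $p$ satisfy $1<p<\infty$ if $n=1,2$ and $1<p\le \frac{n}{n-2}$ if $n\ge 3$. Let $b:[0,\infty)\to[0,\infty)$ be a smooth nonnegative function, and let $(u_0,u_1)\in H^1(\mathbb R^n)\times L^2(\mathbb R^n)$ be real-valued. Consider the Cauchy problem $$u_{tt}-\Delta u+b(t)u_t=|u|^p,\qquad u(0)=u_0,\quad u_t(0)=u_1. \tag{1}$$ For $T\in(0,\infty]$, a strong solution of (1) on $[0,T)$ is a function $$u\in C^2([0,T);H^{-1}(\mathbb R^n))\cap C^1([0,T);L^2(\mathbb R^n))\cap C([0,T);H^1(\mathbb R^n))$$ that satisfies $u(0)=u_0$, $u_t(0)=u_1$ and the equation in $H^{-1}(\mathbb R^n)$ for every $t\in[0,T)$. Let the lifespan $T_0$ be the supremum of all $T\in(0,\infty]$ such that (1) has a strong solution on $[0,T)$. Then there exist a constant $T>0$ and a unique strong solution of (1) on $[0,T)$. Moreover, for every $T\in(0,\infty]$ any two strong solutions of (1) on $[0,T)$ coincide; there is a (unique) strong solution $u$ of (1) on $[0,T_0)$; and the blow-up alternative holds: if $T_0<\infty$,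 then $$\lim_{t\to T_0-}\|(u,u_t)(t)\|_{H^1\times L^2}=\infty .$$ -/

import Mathlib

open MeasureTheory Set Filter Topology
open scoped ContDiff

noncomputable section

namespace DampedWave

/-- The Euclidean space `ℝⁿ`. -/
abbrev Space (n : ℕ) : Type := EuclideanSpace ℝ (Fin n)

/-- `L²(ℝⁿ)`, real-valued. -/
abbrev L2 (n : ℕ) : Type := Lp ℝ 2 (volume : Measure (Space n))

/-- `L²(ℝⁿ; ℝⁿ)`. -/
abbrev L2Vec (n : ℕ) : Type := Lp (Space n) 2 (volume : Measure (Space n))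

/-- `g` is the weak gradient of `f`: `∫ f ∂ᵢφ = - ∫ gᵢ φ` for every test function `φ` and
every coordinate `i`. -/
def IsWeakGrad {n : ℕ} (f : Space n → ℝ) (g : Space n → Space n) : Prop :=
  ∀ φ : Space n → ℝ, ContDiff ℝ ∞ φ → HasCompactSupport φ → ∀ i : Fin n,
    ∫ x, f x * fderiv ℝ φ x (EuclideanSpace.single i 1) = -∫ x, g x i * φ x

theorem integrable_mul_of_test {n : ℕ} {f φ : Space n → ℝ} (hf : MemLp f 2 volume)
    (hφ : Continuous φ) (hc : HasCompactSupport φ) : Integrable (fun x => f x * φ x) :=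
  (hf.locallyIntegrable (by norm_num)).integrable_smul_right_of_hasCompactSupport hφ hc

theorem memLp_coord {n : ℕ} (g : L2Vec n) (i : Fin n) : MemLp (fun x => g x i) 2 volume :=
  (EuclideanSpace.proj (𝕜 := ℝ) i).comp_memLp' (Lp.memLp g)

theorem continuous_partial {n : ℕ} {φ : Space n → ℝ} (hφ : ContDiff ℝ ∞ φ) (v : Space n) :
    Continuous (fun x => fderiv ℝ φ x v) :=
  (hφ.continuous_fderiv (by simp)).clm_apply continuous_const

theorem hasCompactSupport_partial {n : ℕ} {φ : Space n → ℝ} (hc : HasCompactSupport φ)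
    (v : Space n) : HasCompactSupport (fun x => fderiv ℝ φ x v) :=
  hc.fderiv_apply (𝕜 := ℝ) v

/-- `H¹(ℝⁿ)`: the pairs `(f, ∇f)` with `f ∈ L²(ℝⁿ)` whose weak gradient is in `L²`. As a subspace
of the Hilbert space `L²(ℝⁿ) × L²(ℝⁿ; ℝⁿ)` it carries the norm
`(‖f‖² + ∑ᵢ ‖∂ᵢ f‖²) ^ (1/2)`. The second component is determined by the first. -/
def H1 (n : ℕ) : Submodule ℝ (WithLp 2 (L2 n × L2Vec n)) where
  carrier := {w | IsWeakGrad (n := n) w.fst w.snd}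
  zero_mem' := by
    intro φ hφ hc i
    simp
  add_mem' := by
    intro a b ha hb φ hφ hc i
    have h1 : ∀ᵐ x : Space n, ((a + b).fst : Space n → ℝ) x = a.fst x + b.fst x :=
      Lp.coeFn_add a.fst b.fst
    have h2 : ∀ᵐ x : Space n, ((a + b).snd : Space n → Space n) x = a.snd x + b.snd x :=
      Lp.coeFn_add a.snd b.snd
    have c1 := continuous_partial hφ (EuclideanSpace.single i (1 : ℝ))
    have c2 := hasCompactSupport_partial hc (EuclideanSpace.single i (1 : ℝ))
    rw [integral_congr_ae (g := fun x =>
        a.fst x * fderiv ℝ φ x (EuclideanSpace.single i 1)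
          + b.fst x * fderiv ℝ φ x (EuclideanSpace.single i 1)),
      integral_congr_ae (f := fun x => (a + b).snd x i * φ x)
        (g := fun x => a.snd x i * φ x + b.snd x i * φ x),
      integral_add (integrable_mul_of_test (Lp.memLp a.fst) c1 c2)
        (integrable_mul_of_test (Lp.memLp b.fst) c1 c2),
      integral_add (integrable_mul_of_test (memLp_coord a.snd i) hφ.continuous hc)
        (integrable_mul_of_test (memLp_coord b.snd i) hφ.continuous hc),
      ha φ hφ hc i, hb φ hφ hc i, neg_add]
    · filter_upwards [h2] with x hx
      simp only [hx, PiLp.add_apply]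
      ring
    · filter_upwards [h1] with x hx
      simp only [hx]
      ring
  smul_mem' := by
    intro c a ha φ hφ hc i
    have h1 : ∀ᵐ x : Space n, ((c • a).fst : Space n → ℝ) x = c * a.fst x :=
      Lp.coeFn_smul c a.fst
    have h2 : ∀ᵐ x : Space n, ((c • a).snd : Space n → Space n) x = c • a.snd x :=
      Lp.coeFn_smul c a.snd
    rw [integral_congr_ae (g := fun x =>
        c * (a.fst x * fderiv ℝ φ x (EuclideanSpace.single i 1))),
      integral_congr_ae (f := fun x => (c • a).snd x i * φ x)
        (g := fun x => c * (a.snd x i * φ x)),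
      integral_const_mul, integral_const_mul, ha φ hφ hc i, mul_neg]
    · filter_upwards [h2] with x hx
      simp only [hx, PiLp.smul_apply, smul_eq_mul]
      ring
    · filter_upwards [h1] with x hx
      simp only [hx]
      ring

/-- The embedding `H¹(ℝⁿ) → L²(ℝⁿ)`. -/
def toL2 (n : ℕ) : H1 n →L[ℝ] L2 n :=
  (WithLp.fstL 2 ℝ (L2 n) (L2Vec n)).comp (H1 n).subtypeL

/-- The gradient `∇ : H¹(ℝⁿ) → L²(ℝⁿ; ℝⁿ)`. -/
def grad (n : ℕ) : H1 n →L[ℝ] L2Vec n :=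
  (WithLp.sndL 2 ℝ (L2 n) (L2Vec n)).comp (H1 n).subtypeL

/-- `H⁻¹(ℝⁿ)`, the dual of `H¹(ℝⁿ)`, with the dual norm. -/
abbrev HNeg (n : ℕ) : Type := StrongDual ℝ (H1 n)

/-- The embedding `L²(ℝⁿ) → H⁻¹(ℝⁿ)`, `f ↦ (ψ ↦ ∫ f ψ)`. -/
def toHNeg {n : ℕ} (f : L2 n) : HNeg n := (innerSL ℝ f).comp (toL2 n)

/-- The Laplacian `Δ : H¹(ℝⁿ) → H⁻¹(ℝⁿ)`, `u ↦ (ψ ↦ - ∫ ∇u · ∇ψ)`. -/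
def laplacian {n : ℕ} (u : H1 n) : HNeg n := -(innerSL ℝ (grad n u)).comp (grad n)

/-- The element `F` of `H⁻¹(ℝⁿ)` is the function `f`: for all `ψ ∈ H¹(ℝⁿ)` the product `f ψ` is
integrable and `⟨F, ψ⟩ = ∫ f ψ`. -/
def IsGivenBy {n : ℕ} (F : HNeg n) (f : Space n → ℝ) : Prop :=
  ∀ ψ : H1 n, Integrable (fun x => f x * toL2 n ψ x) ∧ F ψ = ∫ x, f x * toL2 n ψ x

/-- The time interval `[0, T)`, where `T ∈ (0, ∞]`. -/
def timeInterval (T : EReal) : Set ℝ := {t | 0 ≤ t ∧ (t : EReal) < T}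

/-- The time derivative `u_t(t)`, taken in `L²(ℝⁿ)` along `[0, T)` (one-sided at `t = 0`). -/
def velocity {n : ℕ} (T : EReal) (u : ℝ → H1 n) (t : ℝ) : L2 n :=
  derivWithin (fun s => toL2 n (u s)) (timeInterval T) t

/-- The second time derivative `u_tt(t)`, taken in `H⁻¹(ℝⁿ)` along `[0, T)`. -/
def acceleration {n : ℕ} (T : EReal) (u : ℝ → H1 n) (t : ℝ) : HNeg n :=
  iteratedDerivWithin 2 (fun s => toHNeg (toL2 n (u s))) (timeInterval T) t

/-- `u` is a strong solution on `[0, T)` of `u_tt - Δu + b(t) u_t = |u|^p`, `u(0) = u₀`,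
`u_t(0) = u₁`. The values of `u` outside `[0, T)` are irrelevant. -/
structure IsStrongSolution {n : ℕ} (p : ℝ) (b : ℝ → ℝ) (u₀ : H1 n) (u₁ : L2 n) (T : EReal)
    (u : ℝ → H1 n) : Prop where
  pos : 0 < T
  continuousOn_H1 : ContinuousOn u (timeInterval T)
  contDiffOn_L2 : ContDiffOn ℝ 1 (fun t => toL2 n (u t)) (timeInterval T)
  contDiffOn_HNeg : ContDiffOn ℝ 2 (fun t => toHNeg (toL2 n (u t))) (timeInterval T)
  initial_position : u 0 = u₀
  initial_velocity : velocity T u 0 = u₁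
  equation : ∀ t ∈ timeInterval T,
    IsGivenBy (acceleration T u t - laplacian (u t) + b t • toHNeg (velocity T u t))
      (fun x => |toL2 n (u t) x| ^ p)

/-- The lifespan `T₀ ∈ [0, ∞]`: the supremum of all `T ∈ (0, ∞]` such that there is a strong
solution on `[0, T)`. -/
def lifespan {n : ℕ} (p : ℝ) (b : ℝ → ℝ) (u₀ : H1 n) (u₁ : L2 n) : EReal :=
  sSup {T : EReal | ∃ u : ℝ → H1 n, IsStrongSolution p b u₀ u₁ T u}

/-- The energy norm `‖(u, u_t)(t)‖` in `H¹(ℝⁿ) × L²(ℝⁿ)`. -/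
def energyNorm {n : ℕ} (T : EReal) (u : ℝ → H1 n) (t : ℝ) : ℝ :=
  Real.sqrt (‖u t‖ ^ 2 + ‖velocity T u t‖ ^ 2)

end DampedWave

end

/-! Adding u to both sides turns the equation into the first order system U' = A U + N(t, U) for U =
(u, u_t) in H¹ × L², where A(u, v) = (v, -(1 - Δ)u) is the Klein-Gordon generator and N(t, (u, v)) =
(0, |u|^p - b v + u). The mass term makes A skew-adjoint for the given norm of H¹ × L², with a
bounded inverse. The power nonlinearity costs no derivative: 2p ≤ 2n/(n-2) when n ≥ 3, so H¹ embeds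
in L^{2p} and u ↦ |u|^p is locally Lipschitz from H¹ to L² (`exists_nemytskii`).

Unbounded operators never appear. With J : H¹ → L² the inclusion, J* is (1 - Δ)⁻¹, and A is encoded
by the bounded injective skew-adjoint operator K(u, v) = (-J* v, J u) = A⁻¹. Stone's theorem for K⁻¹
(`exists_skewGroup`) gives a group S of isometries, and the system reads (K U)' = U + K N(t, U). The
Riesz isomorphism turns the first component of this identity into the wave equation in H⁻¹; the
second says that u_t = v in L². So it is equivalent to the notion of strong solution.

In the moving frame Y(t) = S(-t) U(t) the generator cancels, and Y solves an ordinary differential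
equation in a Hilbert space whose field S(-t) N(t, S(t) Y) is continuous and locally Lipschitz
(`IsWeakSolution.isODESolution`, `IsODESolution.isWeakSolution`). Local existence, uniqueness, the
maximal solution and blow-up of the norm are then Picard-Lindelöf theory. They transfer back because
the correspondence works on every interval [0, T), so the lifespans agree, and because ‖Y(t)‖ =
‖U(t)‖ is the energy norm. -/

noncomputable section

namespace DampedWave

/-! ### Stone's theorem, formulated through a bounded inverse of the generator. -/

section SkewGroup

open ContinuousLinearMap
open scoped InnerProductSpace

variable {E : Type*} [NormedAddCommGroup E] [InnerProductSpace ℝ E] [CompleteSpace E]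

theorem inner_skew {K : E →L[ℝ] E} (hK : star K = -K) (x y : E) :
    ⟪K x, y⟫_ℝ = -⟪x, K y⟫_ℝ := by
  rw [← ContinuousLinearMap.adjoint_inner_right, ← ContinuousLinearMap.star_eq_adjoint, hK]
  simp

/-- The orthogonal complement of the range is the kernel of K* = -K, which is trivial. -/
theorem denseRange_of_skew {K : E →L[ℝ] E} (hK : star K = -K) (hinj : Function.Injective K) :
    DenseRange K := by
  have h : (K : E →ₗ[ℝ] E).range.topologicalClosure = ⊤ := by
    rw [Submodule.topologicalClosure_eq_top_iff, ContinuousLinearMap.orthogonal_range,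
      ← ContinuousLinearMap.star_eq_adjoint, hK, LinearMap.ker_eq_bot]
    intro x y hxy
    exact hinj (neg_injective hxy)
  rw [DenseRange, dense_iff_closure_eq]
  have := congrArg (fun S : Submodule ℝ E => (S : Set E)) h
  exact this

/-- The resolvent `(a - K²)⁻¹` of the square of a skew-adjoint operator. -/
theorem exists_resolvent {K : E →L[ℝ] E} (hK : star K = -K) {a : ℝ} (ha : 0 < a) :
    ∃ R : E →L[ℝ] E, (∀ T : E →L[ℝ] E, Commute T K → Commute T R) ∧ star R = R ∧
      (∀ x, a • R x - K (K (R x)) = x) ∧ ∀ x, ‖a • R x‖ ≤ ‖x‖ := by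
  set P : E →L[ℝ] E := a • 1 - K * K with hP
  have hPx : ∀ x, P x = a • x - K (K x) := fun x => by simp [hP]
  have hin : ∀ x, a * ‖x‖ ^ 2 ≤ ⟪P x, x⟫_ℝ := by
    intro x
    rw [hPx, inner_sub_left, inner_smul_left, inner_skew hK, real_inner_self_eq_norm_sq,
      real_inner_self_eq_norm_sq]
    have := sq_nonneg ‖K x‖
    simp only [conj_trivial]
    linarith
  -- Lax-Milgram: the skew part only helps, since ⟨-K²x, x⟩ = ‖Kx‖² ≥ 0, so P is coercive with
  -- constant a.
  have hu : IsUnit P := by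
    refine isUnit_of_forall_le_norm_inner_map P (c := ⟨a, ha.le⟩) ha fun x => ?_
    rw [Real.norm_eq_abs]
    exact le_trans (by rw [mul_comm]; exact hin x) (le_abs_self _)
  obtain ⟨u, hu⟩ := hu
  have hPs : star P = P := by
    rw [hP, star_sub, star_smul, star_mul, hK]
    simp
  have hPR : ∀ x, P ((↑u⁻¹ : E →L[ℝ] E) x) = x := fun x => by
    have : P * (↑u⁻¹ : E →L[ℝ] E) = 1 := by rw [← hu]; exact u.mul_inv
    exact congrArg (fun T : E →L[ℝ] E => T x) this
  refine ⟨↑u⁻¹, fun T hT => ?_, ?_, fun x => ?_, fun x => ?_⟩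
  · refine Commute.units_inv_right ?_
    rw [hu, hP]
    exact ((Commute.one_right T).smul_right a).sub_right (hT.mul_right hT)
  · refine left_inv_eq_right_inv (a := P) ?_ (by rw [← hu]; exact u.mul_inv)
    have : P * (↑u⁻¹ : E →L[ℝ] E) = 1 := by rw [← hu]; exact u.mul_inv
    have := congrArg star this
    rwa [star_mul, hPs, star_one] at this
  · rw [← hPx, hPR]
  · set w := (↑u⁻¹ : E →L[ℝ] E) x with hw
    have h1 := hin w
    rw [hPR] at h1
    have h2 := real_inner_le_norm x w
    rw [norm_smul, Real.norm_of_nonneg ha.le]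
    rcases eq_or_ne ‖w‖ 0 with h0 | h0
    · simp [h0]
    · have h3 : 0 < ‖w‖ := lt_of_le_of_ne (norm_nonneg _) (Ne.symm h0)
      refine le_of_mul_le_mul_right ?_ h3
      nlinarith

/-- Yosida approximations of the unbounded skew-adjoint operator `K⁻¹`. -/
theorem exists_yosida {K : E →L[ℝ] E} (hK : star K = -K) (hinj : Function.Injective K) :
    ∃ A : ℕ → E →L[ℝ] E, (∀ k, star (A k) = -A k) ∧ (∀ k, Commute K (A k)) ∧
      (∀ k l, Commute (A k) (A l)) ∧ (∀ k x, ‖A k (K x)‖ ≤ 2 * ‖x‖) ∧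
      ∀ x, Tendsto (fun k => A k (K x)) atTop (𝓝 x) := by
  have ha : ∀ k : ℕ, (0 : ℝ) < 1 / ((k : ℝ) + 1) := fun k => by positivity
  choose R hR1 hR2 hR3 hR4 using fun k => exists_resolvent hK (ha k)
  have hKR : ∀ k, Commute K (R k) := fun k => hR1 k K (Commute.refl K)
  have hKRx : ∀ k x, R k (K x) = K (R k x) := fun k x =>
    (congrArg (fun T : E →L[ℝ] E => T x) (hKR k).eq).symm
  -- With a = 1/(k+1) and R = (a - K²)⁻¹, the approximation of K⁻¹ is -K R; its product with K is
  -- -K²R = 1 - aR, of norm at most 2.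
  have hA : ∀ k x, (-(K * R k)) (K x) = x - (1 / ((k : ℝ) + 1)) • R k x := by
    intro k x
    have := hR3 k x
    rw [neg_apply, mul_def, comp_apply, hKRx]
    nth_rw 2 [← this]
    abel
  refine ⟨fun k => -(K * R k), fun k => ?_, fun k => ?_, fun k l => ?_, fun k x => ?_, fun x => ?_⟩
  · rw [star_neg, star_mul, hK, hR2, mul_neg, ← (hKR k).eq]
  · exact ((Commute.refl K).mul_right (hKR k)).neg_right
  · refine Commute.neg_left (Commute.neg_right ?_)
    have h1 : Commute (K * R k) K := (Commute.refl K).mul_left (hKR k).symm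
    exact h1.mul_right (hR1 l _ h1)
  · rw [hA]
    have := norm_sub_le x ((1 / ((k : ℝ) + 1)) • R k x)
    have := hR4 k x
    linarith
  · simp only [hA]
    -- On the dense range of K² the identity aR K²z = a(aRz - z) gives size O(a); the bound ‖aR‖ ≤ 1
    -- extends the convergence to every x.
    have hz : ∀ x, Tendsto (fun k : ℕ => (1 / ((k : ℝ) + 1)) • R k x) atTop (𝓝 0) := by
      intro x
      have hd : DenseRange (K * K : E →L[ℝ] E) := by
        have := denseRange_of_skew hK hinj
        exact this.comp this K.continuous
      rw [Metric.tendsto_atTop]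
      intro ε hε
      obtain ⟨z, hz⟩ := hd.exists_dist_lt x (half_pos hε)
      have ht : Tendsto (fun k : ℕ => (1 / ((k : ℝ) + 1)) * (2 * ‖z‖)) atTop (𝓝 0) := by
        simpa using tendsto_one_div_add_atTop_nhds_zero_nat.mul_const (2 * ‖z‖)
      obtain ⟨N, hN⟩ := (Metric.tendsto_atTop.1 ht) (ε / 2) (half_pos hε)
      refine ⟨N, fun k hk => ?_⟩
      have h1 := hN k hk
      rw [Real.dist_0_eq_abs, abs_of_nonneg (by positivity)] at h1
      have h2 : (1 / ((k : ℝ) + 1)) • R k (K (K z)) =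
          (1 / ((k : ℝ) + 1)) • ((1 / ((k : ℝ) + 1)) • R k z - z) := by
        congr 1
        rw [hKRx, hKRx]
        nth_rw 3 [← hR3 k z]
        abel
      have h3 : ‖(1 / ((k : ℝ) + 1)) • R k (K (K z))‖ ≤ (1 / ((k : ℝ) + 1)) * (2 * ‖z‖) := by
        rw [h2, norm_smul, Real.norm_of_nonneg (ha k).le]
        have := norm_sub_le ((1 / ((k : ℝ) + 1)) • R k z) z
        have := hR4 k z
        gcongr
        linarith
      have h4 := hR4 k (x - K (K z))
      rw [map_sub, smul_sub] at h4
      rw [dist_eq_norm] at hz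
      have h5 := norm_add_le ((1 / ((k : ℝ) + 1)) • R k x - (1 / ((k : ℝ) + 1)) • R k (K (K z)))
        ((1 / ((k : ℝ) + 1)) • R k (K (K z)))
      rw [sub_add_cancel] at h5
      rw [dist_zero_right]
      simp only [mul_def, comp_apply] at hz
      linarith
    simpa using tendsto_const_nhds.sub (hz x)

theorem norm_exp_skew {A : E →L[ℝ] E} (hA : star A = -A) (t : ℝ) (x : E) :
    ‖NormedSpace.exp (t • A) x‖ = ‖x‖ := by
  let _ : NormedAlgebra ℚ (E →L[ℝ] E) := NormedAlgebra.restrictScalars ℚ ℝ _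
  have h : t • A ∈ skewAdjoint (E →L[ℝ] E) := by
    rw [skewAdjoint.mem_iff, star_smul, hA]
    simp
  have hu : NormedSpace.exp (t • A) ∈ unitary (E →L[ℝ] E) :=
    NormedSpace.exp_mem_unitary_of_mem_skewAdjoint h
  exact Unitary.norm_map ⟨_, hu⟩ x

theorem hasDerivAt_exp_apply (A : E →L[ℝ] E) (x : E) (t : ℝ) :
    HasDerivAt (fun s : ℝ => NormedSpace.exp (s • A) x) (NormedSpace.exp (t • A) (A x)) t :=
  (ContinuousLinearMap.apply ℝ E x).hasFDerivAt.comp_hasDerivAt t (hasDerivAt_exp_smul_const A t)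

theorem norm_exp_skew_sub_le {A : E →L[ℝ] E} (hA : star A = -A) (t : ℝ) (x : E) :
    ‖NormedSpace.exp (t • A) x - x‖ ≤ ‖A x‖ * |t| := by
  have := convex_univ.norm_image_sub_le_of_norm_hasDerivWithin_le (s := univ)
    (x := (0 : ℝ)) (y := t)
    (fun s _ => (hasDerivAt_exp_apply A x s).hasDerivWithinAt)
    (fun s _ => (norm_exp_skew hA s (A x)).le) (mem_univ _) (mem_univ _)
  simpa using this

/-- Commutativity factors exp(tA) as exp(tB) exp(t(A - B)), and the isometry exp(tB) drops out,
leaving a bound on exp(t(A - B))x - x. -/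
theorem norm_exp_sub_exp_le {A B : E →L[ℝ] E} (hA : star A = -A) (hB : star B = -B)
    (hAB : Commute A B) (t : ℝ) (x : E) :
    ‖NormedSpace.exp (t • A) x - NormedSpace.exp (t • B) x‖ ≤ ‖A x - B x‖ * |t| := by
  let _ : NormedAlgebra ℚ (E →L[ℝ] E) := NormedAlgebra.restrictScalars ℚ ℝ _
  have h : NormedSpace.exp (t • A) = NormedSpace.exp (t • B) * NormedSpace.exp (t • (A - B)) := by
    rw [← NormedSpace.exp_add_of_commute]
    · congr 1
      rw [← smul_add]; congr 1; abel
    · exact ((hAB.symm.sub_right (Commute.refl B)).smul_left t).smul_right t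
  rw [h, mul_def, comp_apply, ← map_sub, norm_exp_skew hB]
  exact norm_exp_skew_sub_le (by rw [star_sub, hA, hB]; abel) t x

/-- **Stone's theorem** for the inverse of an injective bounded skew-adjoint operator `K`: the
operator `K⁻¹` generates a strongly continuous one-parameter group of isometries. -/
theorem exists_skewGroup {K : E →L[ℝ] E} (hK : star K = -K) (hinj : Function.Injective K) :
    ∃ S : ℝ → E →L[ℝ] E, (∀ t x, ‖S t x‖ = ‖x‖) ∧ (∀ s t x, S (s + t) x = S s (S t x)) ∧
      (∀ x, S 0 x = x) ∧ (∀ t x, S t (K x) = K (S t x)) ∧ (∀ x, Continuous fun t => S t x) ∧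
      ∀ x t, HasDerivAt (fun s => S s (K x)) (S t x) t := by
  let _ : NormedAlgebra ℚ (E →L[ℝ] E) := NormedAlgebra.restrictScalars ℚ ℝ _
  obtain ⟨A, hA, hKA, hAA, hb, hlim⟩ := exists_yosida hK hinj
  set V : ℕ → ℝ → E →L[ℝ] E := fun k t => NormedSpace.exp (t • A k) with hV
  have hVn : ∀ k t x, ‖V k t x‖ = ‖x‖ := fun k t x => norm_exp_skew (hA k) t x
  have hd := denseRange_of_skew hK hinj
  -- On the range of K the approximate groups differ by at most |t| ‖A_k K z - A_N K z‖, which is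
  -- small. Density of this range and the isometry property cover all x by an ε/3 argument.
  have hcau : ∀ t x, ∃ y, Tendsto (fun k => V k t x) atTop (𝓝 y) := by
    intro t x
    refine cauchySeq_tendsto_of_complete (Metric.cauchySeq_iff'.2 fun ε hε => ?_)
    obtain ⟨z, hz⟩ := hd.exists_dist_lt x (show 0 < ε / 3 by positivity)
    have h1 : CauchySeq fun k => A k (K z) := (hlim z).cauchySeq
    obtain ⟨N, hN⟩ := Metric.cauchySeq_iff'.1 h1 (ε / 3 / (|t| + 1)) (by positivity)
    refine ⟨N, fun k hk => ?_⟩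
    have h2 := hN k hk
    rw [dist_eq_norm, lt_div_iff₀ (by positivity)] at h2
    have h3 := norm_exp_sub_exp_le (hA k) (hA N) (hAA k N) t (K z)
    have h4 : ‖V k t (x - K z)‖ < ε / 3 := by rw [hVn, ← dist_eq_norm]; exact hz
    have h5 : ‖V N t (x - K z)‖ < ε / 3 := by rw [hVn, ← dist_eq_norm]; exact hz
    have h6 : V k t x - V N t x =
        (V k t (K z) - V N t (K z)) + V k t (x - K z) - V N t (x - K z) := by
      simp only [map_sub]; abel
    rw [dist_eq_norm, h6]
    have h7 := norm_sub_le ((V k t (K z) - V N t (K z)) + V k t (x - K z)) (V N t (x - K z))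
    have h8 := norm_add_le (V k t (K z) - V N t (K z)) (V k t (x - K z))
    have h9 : ‖A k (K z) - A N (K z)‖ * |t| ≤ ‖A k (K z) - A N (K z)‖ * (|t| + 1) := by
      gcongr; linarith
    simp only [hV] at h7 h8 ⊢ h4 h5
    linarith
  choose S₀ hS₀ using hcau
  have hSn : ∀ t x, ‖S₀ t x‖ = ‖x‖ := fun t x =>
    tendsto_nhds_unique (hS₀ t x).norm (by simp [hVn])
  let S : ℝ → E →L[ℝ] E := fun t => LinearMap.mkContinuous
    { toFun := S₀ t
      map_add' := fun x y => tendsto_nhds_unique (hS₀ t (x + y)) (by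
        simpa using (hS₀ t x).add (hS₀ t y))
      map_smul' := fun c x => tendsto_nhds_unique (hS₀ t (c • x)) (by
        simpa using (hS₀ t x).const_smul c) } 1 (fun x => by simp [hSn])
  have hS : ∀ t x, Tendsto (fun k => V k t x) atTop (𝓝 (S t x)) := hS₀
  have hSn : ∀ t x, ‖S t x‖ = ‖x‖ := hSn
  have hSK : ∀ t x, S t (K x) = K (S t x) := by
    intro t x
    refine tendsto_nhds_unique (hS t (K x)) ?_
    have h1 : ∀ k, V k t (K x) = K (V k t x) := fun k => by
      have : Commute K (V k t) := ((hKA k).smul_right t).exp_right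
      exact (congrArg (fun T : E →L[ℝ] E => T x) this.eq).symm
    simp only [h1]
    exact (K.continuous.tendsto _).comp (hS t x)
  have hSadd : ∀ s t x, S (s + t) x = S s (S t x) := by
    intro s t x
    refine tendsto_nhds_unique (hS (s + t) x) ?_
    have h1 : ∀ k, V k (s + t) x = V k s (V k t x - S t x) + V k s (S t x) := fun k => by
      have : V k (s + t) = V k s * V k t := by
        simp only [hV]
        rw [add_smul, NormedSpace.exp_add_of_commute]
        exact ((Commute.refl (A k)).smul_left s).smul_right t
      rw [this, map_sub]; simp
    simp only [h1]
    have h2 : Tendsto (fun k => V k s (V k t x - S t x)) atTop (𝓝 0) := by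
      rw [tendsto_zero_iff_norm_tendsto_zero]
      simp only [hVn]
      rw [← tendsto_zero_iff_norm_tendsto_zero]
      simpa using (hS t x).sub_const (S t x)
    simpa using h2.add (hS s (S t x))
  have hS0 : ∀ x, S 0 x = x := fun x => tendsto_nhds_unique (hS 0 x) (by simp [hV])
  -- Orbits starting in the range of K are Lipschitz in time, because ‖A_k K z‖ ≤ 2‖z‖ uniformly in
  -- k; density then yields strong continuity.
  have hlip : ∀ z t s, ‖S t (K z) - S s (K z)‖ ≤ 2 * ‖z‖ * |t - s| := by
    intro z t s
    have h1 : S t (K z) - S s (K z) = S s (S (t - s) (K z) - K z) := by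
      rw [map_sub, ← hSadd]; simp
    rw [h1, hSn]
    refine le_of_tendsto ((hS (t - s) (K z)).sub_const (K z)).norm (Eventually.of_forall fun k => ?_)
    refine (norm_exp_skew_sub_le (hA k) (t - s) (K z)).trans ?_
    gcongr
    exact hb k z
  have hcont : ∀ x, Continuous fun t => S t x := by
    intro x
    rw [Metric.continuous_iff]
    intro s ε hε
    obtain ⟨z, hz⟩ := hd.exists_dist_lt x (show 0 < ε / 3 by positivity)
    refine ⟨ε / 3 / (2 * ‖z‖ + 1), by positivity, fun t ht => ?_⟩
    rw [Real.dist_eq, lt_div_iff₀ (by positivity)] at ht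
    have h1 := hlip z t s
    have h4 : ‖S t (x - K z)‖ < ε / 3 := by rw [hSn, ← dist_eq_norm]; exact hz
    have h5 : ‖S s (x - K z)‖ < ε / 3 := by rw [hSn, ← dist_eq_norm]; exact hz
    have h6 : S t x - S s x = (S t (K z) - S s (K z)) + S t (x - K z) - S s (x - K z) := by
      simp only [map_sub]; abel
    rw [dist_eq_norm, h6]
    have h7 := norm_sub_le ((S t (K z) - S s (K z)) + S t (x - K z)) (S s (x - K z))
    have h8 := norm_add_le (S t (K z) - S s (K z)) (S t (x - K z))
    have h9 := abs_nonneg (t - s)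
    nlinarith
  refine ⟨S, hSn, hSadd, hS0, hSK, hcont, fun x t => ?_⟩
  -- The derivative survives the limit in integrated form, by dominated convergence with bound 2‖x‖.
  have hint : ∀ t, S t (K x) = K x + ∫ s in (0 : ℝ)..t, S s x := by
    intro t
    have h1 : ∀ k, V k t (K x) = K x + ∫ s in (0 : ℝ)..t, V k s (A k (K x)) := by
      intro k
      have hc : Continuous fun s => V k s (A k (K x)) :=
        continuous_iff_continuousAt.2 fun s => (hasDerivAt_exp_apply (A k) (A k (K x)) s).continuousAt
      rw [intervalIntegral.integral_eq_sub_of_hasDerivAt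
        (fun s _ => hasDerivAt_exp_apply (A k) (K x) s) (hc.intervalIntegrable 0 t)]
      simp [hV]
    refine tendsto_nhds_unique (hS t (K x)) ?_
    simp only [h1]
    refine tendsto_const_nhds.add ?_
    refine intervalIntegral.tendsto_integral_filter_of_dominated_convergence (fun _ => 2 * ‖x‖)
      (Eventually.of_forall fun k => ?_) (Eventually.of_forall fun k => ?_) (by simp)
      (Eventually.of_forall fun s _ => ?_)
    · have hc : Continuous fun s => V k s (A k (K x)) :=
        continuous_iff_continuousAt.2 fun s => (hasDerivAt_exp_apply (A k) (A k (K x)) s).continuousAt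
      exact hc.aestronglyMeasurable
    · exact Eventually.of_forall fun s _ => by rw [hVn]; exact hb k x
    · have h2 : Tendsto (fun k => V k s (A k (K x) - x)) atTop (𝓝 0) := by
        rw [tendsto_zero_iff_norm_tendsto_zero]
        simp only [hVn]
        rw [← tendsto_zero_iff_norm_tendsto_zero]
        simpa using (hlim x).sub_const x
      simpa using h2.add (hS s x)
  have h2 : (fun s => S s (K x)) = fun t => K x + ∫ s in (0 : ℝ)..t, S s x := funext hint
  rw [h2]
  exact (intervalIntegral.integral_hasDerivAt_right ((hcont x).intervalIntegrable 0 t)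
    ((hcont x).stronglyMeasurableAtFilter _ _) (hcont x).continuousAt).const_add _

end SkewGroup

/-! ### Topology of the half-open interval [0, T). -/

section TimeInterval

theorem mem_timeInterval_coe {T t : ℝ} : t ∈ timeInterval (T : EReal) ↔ 0 ≤ t ∧ t < T := by
  simp [timeInterval]

theorem timeInterval_mono {S T : EReal} (h : S ≤ T) : timeInterval S ⊆ timeInterval T :=
  fun _ ht => ⟨ht.1, ht.2.trans_le h⟩

theorem zero_mem_timeInterval {T : EReal} (h : 0 < T) : (0 : ℝ) ∈ timeInterval T :=
  ⟨le_rfl, by simpa using h⟩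

theorem timeInterval_eq (T : EReal) : timeInterval T = Ici 0 ∩ {t : ℝ | (t : EReal) < T} := rfl

theorem isOpen_coe_lt (T : EReal) : IsOpen {t : ℝ | (t : EReal) < T} :=
  isOpen_Iio.preimage continuous_coe_real_ereal

theorem Icc_subset_timeInterval {T : EReal} {t : ℝ} (ht : t ∈ timeInterval T) :
    Icc 0 t ⊆ timeInterval T :=
  fun _ hs => ⟨hs.1, (EReal.coe_le_coe_iff.2 hs.2).trans_lt ht.2⟩

/-- A neighborhood of `t` within `[0, T)` is also one within `[0, S)`. -/
theorem timeInterval_mem_nhdsWithin {S T : EReal} {t : ℝ} (ht : (t : EReal) < S) :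
    timeInterval S ∈ 𝓝[timeInterval T] t := by
  have := inter_mem_nhdsWithin (timeInterval T) ((isOpen_coe_lt S).mem_nhds ht)
  exact mem_of_superset this fun s hs => ⟨hs.1.1, hs.2⟩

theorem timeInterval_mem_nhdsGE {T : EReal} {t : ℝ} (ht : t ∈ timeInterval T) :
    timeInterval T ∈ 𝓝[≥] t := by
  have := inter_mem_nhdsWithin (Ici t) ((isOpen_coe_lt T).mem_nhds ht.2)
  exact mem_of_superset this fun s hs => ⟨ht.1.trans hs.1, hs.2⟩

theorem exists_real_between {T : EReal} {t : ℝ} (ht : t ∈ timeInterval T) :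
    ∃ s : ℝ, t < s ∧ s ∈ timeInterval T := by
  obtain ⟨s, hs1, hs2⟩ := EReal.lt_iff_exists_real_btwn.1 ht.2
  have hs1 := EReal.coe_lt_coe_iff.1 hs1
  exact ⟨s, hs1, ht.1.trans hs1.le, hs2⟩

theorem uniqueDiffOn_timeInterval (T : EReal) : UniqueDiffOn ℝ (timeInterval T) := by
  rw [timeInterval_eq]
  exact (uniqueDiffOn_Ici 0).inter (isOpen_coe_lt T)

end TimeInterval

/-! ### Picard-Lindelöf theory: uniqueness, maximal solutions, blow-up. -/

section ODE

open Metric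
open scoped NNReal

variable {E : Type*} [NormedAddCommGroup E] [NormedSpace ℝ E]

/-- `Y` solves the initial value problem `Y' = F(t, Y)`, `Y(0) = y₀` on `[0, T)`. -/
structure IsODESolution (F : ℝ → E → E) (y₀ : E) (T : EReal) (Y : ℝ → E) : Prop where
  initial : Y 0 = y₀
  deriv : ∀ t ∈ timeInterval T, HasDerivWithinAt Y (F t (Y t)) (timeInterval T) t

/-- The field `F` is locally Lipschitz in space, uniformly on bounded time intervals. -/
def IsLocallyLipschitzField (F : ℝ → E → E) : Prop :=
  ∀ T R : ℝ, ∃ L : ℝ≥0, ∀ t ∈ Icc 0 T, LipschitzOnWith L (F t) (closedBall 0 R)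

variable {F : ℝ → E → E} {y₀ : E} {S T : EReal} {Y Z : ℝ → E}

theorem IsODESolution.continuousOn (h : IsODESolution F y₀ T Y) :
    ContinuousOn Y (timeInterval T) := fun t ht => (h.deriv t ht).continuousWithinAt

theorem IsODESolution.mono (h : IsODESolution F y₀ T Y) (hST : S ≤ T) : IsODESolution F y₀ S Y :=
  ⟨h.initial, fun t ht => (h.deriv t (timeInterval_mono hST ht)).mono (timeInterval_mono hST)⟩

/-- On the compact interval [0, t] both curves stay in a common ball, where one Lipschitz constant
is enough for Grönwall's inequality. -/
theorem IsODESolution.eqOn (hF : IsLocallyLipschitzField F) (hY : IsODESolution F y₀ T Y)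
    (hZ : IsODESolution F y₀ T Z) : EqOn Y Z (timeInterval T) := by
  intro t ht
  have hsub := Icc_subset_timeInterval ht
  obtain ⟨R₁, h₁⟩ := (isCompact_Icc.image_of_continuousOn (hY.continuousOn.mono
    hsub)).isBounded.subset_closedBall 0
  obtain ⟨R₂, h₂⟩ := (isCompact_Icc.image_of_continuousOn (hZ.continuousOn.mono
    hsub)).isBounded.subset_closedBall 0
  obtain ⟨L, hL⟩ := hF t (max R₁ R₂)
  refine ODE_solution_unique_of_mem_Icc_right (v := F) (s := fun _ => closedBall 0 (max R₁ R₂))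
    (K := L)
    (fun s hs => hL s (Ico_subset_Icc_self hs)) (hY.continuousOn.mono hsub)
    (fun s hs => ?_) (fun s hs => ?_) (hZ.continuousOn.mono hsub) (fun s hs => ?_) (fun s hs => ?_)
    (hY.initial.trans hZ.initial.symm) (right_mem_Icc.2 ht.1)
  · have hs' := hsub (Ico_subset_Icc_self hs)
    exact (hY.deriv s hs').mono_of_mem_nhdsWithin (timeInterval_mem_nhdsGE hs')
  · exact closedBall_subset_closedBall (le_max_left _ _)
      (h₁ (mem_image_of_mem _ (Ico_subset_Icc_self hs)))
  · have hs' := hsub (Ico_subset_Icc_self hs)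
    exact (hZ.deriv s hs').mono_of_mem_nhdsWithin (timeInterval_mem_nhdsGE hs')
  · exact closedBall_subset_closedBall (le_max_right _ _)
      (h₂ (mem_image_of_mem _ (Ico_subset_Icc_self hs)))

/-- Local existence with a time of existence that only depends on bounds for the data. -/
theorem exists_uniform_local_solution [CompleteSpace E] (hF : IsLocallyLipschitzField F)
    (hFc : ∀ y, Continuous fun t => F t y) (T R : ℝ) :
    ∃ δ : ℝ, 0 < δ ∧ ∀ t₀ ∈ Icc 0 T, ∀ y ∈ closedBall (0 : E) R, ∃ Z : ℝ → E, Z t₀ = y ∧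
      ∀ t ∈ Icc t₀ (t₀ + δ), HasDerivWithinAt Z (F t (Z t)) (Icc t₀ (t₀ + δ)) t := by
  obtain ⟨L, hL⟩ := hF (T + 1) (|R| + 1)
  obtain ⟨M, hM⟩ := (isCompact_Icc (a := (0 : ℝ)) (b := T + 1)).exists_bound_of_continuousOn
    (hFc 0).continuousOn
  set B : ℝ := |M| + L * (|R| + 1) with hB
  have hB0 : 0 ≤ B := by positivity
  -- The bound δ ≤ 1 keeps times inside [0, T + 1]. The bound Bδ ≤ 1 keeps the Picard iteration in
  -- the unit ball around y, on which B bounds the field.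
  set δ : ℝ := min 1 (1 / (B + 1)) with hδ
  have hδ0 : 0 < δ := by positivity
  refine ⟨δ, hδ0, fun t₀ ht₀ y hy => ?_⟩
  have hsub : Icc t₀ (t₀ + δ) ⊆ Icc 0 (T + 1) :=
    Icc_subset_Icc ht₀.1 (add_le_add ht₀.2 (min_le_left _ _))
  have hball : closedBall y 1 ⊆ closedBall (0 : E) (|R| + 1) := by
    intro z hz
    rw [mem_closedBall_zero_iff] at hy ⊢
    rw [mem_closedBall, dist_eq_norm] at hz
    have := norm_add_le (z - y) y
    rw [sub_add_cancel] at this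
    linarith [le_abs_self R]
  have hPL : IsPicardLindelof F (tmin := t₀) (tmax := t₀ + δ) ⟨t₀, left_mem_Icc.2 (by linarith)⟩ y
      1 0 ⟨B, hB0⟩ L := by
    refine ⟨fun t ht => (hL t (hsub ht)).mono (by simpa using hball),
      fun x _ => (hFc x).continuousOn, fun t ht x hx => ?_, ?_⟩
    · have hx' : x ∈ closedBall (0 : E) (|R| + 1) := hball (by simpa using hx)
      have h1 := (hL t (hsub ht)).dist_le_mul x hx' 0 (by simp; positivity)
      rw [dist_eq_norm, dist_zero_right] at h1
      rw [mem_closedBall_zero_iff] at hx'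
      have h2 := norm_add_le (F t x - F t 0) (F t 0)
      rw [sub_add_cancel] at h2
      have h3 := hM t (hsub ht)
      have h4 : (L : ℝ) * ‖x‖ ≤ L * (|R| + 1) := by gcongr
      change ‖F t x‖ ≤ |M| + L * (|R| + 1)
      linarith [le_abs_self M]
    · simp only [add_sub_cancel_left, sub_self, NNReal.coe_one, NNReal.coe_zero, sub_zero,
        max_eq_left hδ0.le]
      calc B * δ ≤ B * (1 / (B + 1)) := by gcongr; exact min_le_right _ _
        _ ≤ 1 := by rw [mul_one_div, div_le_one (by linarith)]; linarith
  obtain ⟨Z, hZ0, hZ⟩ := hPL.exists_eq_forall_mem_Icc_hasDerivWithinAt₀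
  exact ⟨Z, hZ0, hZ⟩

/-- Concatenation of solutions. -/
theorem IsODESolution.extend (hY : IsODESolution F y₀ T Y) {t₀ δ : ℝ} (ht₀ : t₀ ∈ timeInterval T)
    (hZ0 : Z t₀ = Y t₀)
    (hZ : ∀ t ∈ Icc t₀ (t₀ + δ), HasDerivWithinAt Z (F t (Z t)) (Icc t₀ (t₀ + δ)) t) :
    IsODESolution F y₀ ((t₀ + δ : ℝ) : EReal) (fun s => if s ≤ t₀ then Y s else Z s) := by
  refine ⟨by simp [ht₀.1, hY.initial], fun t ht => ?_⟩
  rw [mem_timeInterval_coe] at ht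
  have hsplit : timeInterval ((t₀ + δ : ℝ) : EReal) ⊆ Icc 0 t₀ ∪ Icc t₀ (t₀ + δ) := by
    intro s hs
    rw [mem_timeInterval_coe] at hs
    rcases le_total s t₀ with h | h
    · exact Or.inl ⟨hs.1, h⟩
    · exact Or.inr ⟨h, hs.2.le⟩
  have hA : ∀ t, 0 ≤ t → t ≤ t₀ →
      HasDerivWithinAt (fun s => if s ≤ t₀ then Y s else Z s) (F t (Y t)) (Icc 0 t₀) t :=
    fun t h0 h => ((hY.deriv t (Icc_subset_timeInterval ht₀ ⟨h0, h⟩)).mono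
      (Icc_subset_timeInterval ht₀)).congr (fun s hs => if_pos hs.2) (if_pos h)
  have hB : ∀ t, t₀ ≤ t → t ≤ t₀ + δ →
      HasDerivWithinAt (fun s => if s ≤ t₀ then Y s else Z s) (F t (Z t)) (Icc t₀ (t₀ + δ)) t := by
    have : ∀ s, t₀ ≤ s → (if s ≤ t₀ then Y s else Z s) = Z s := by
      intro s hs
      split_ifs with h
      · rw [le_antisymm h hs, hZ0]
      · rfl
    exact fun t h0 h => (hZ t ⟨h0, h⟩).congr (fun s hs => this s hs.1) (this t h0)
  rcases lt_trichotomy t t₀ with h | h | h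
  · rw [if_pos h.le]
    refine (hA t ht.1 h.le).mono_of_mem_nhdsWithin ?_
    filter_upwards [self_mem_nhdsWithin, mem_nhdsWithin_of_mem_nhds (Iio_mem_nhds h)] with s hs hs'
    exact ⟨hs.1, le_of_lt hs'⟩
  -- At the junction the two one-sided derivatives agree because Z and Y take the same value there.
  · subst h
    rw [if_pos le_rfl]
    have h1 := hB t le_rfl ht.2.le
    rw [hZ0] at h1
    exact ((hA t ht.1 le_rfl).union h1).mono hsplit
  · rw [if_neg (not_le.2 h)]
    refine (hB t h.le ht.2.le).mono_of_mem_nhdsWithin ?_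
    filter_upwards [self_mem_nhdsWithin, mem_nhdsWithin_of_mem_nhds (Ioi_mem_nhds h)] with s hs hs'
    rw [mem_timeInterval_coe] at hs
    exact ⟨le_of_lt hs', hs.2.le⟩

/-- The supremum of the existence times of solutions. -/
def odeLifespan (F : ℝ → E → E) (y₀ : E) : EReal :=
  sSup {T : EReal | 0 < T ∧ ∃ Y : ℝ → E, IsODESolution F y₀ T Y}

theorem exists_odeSolution [CompleteSpace E] (hF : IsLocallyLipschitzField F)
    (hFc : ∀ y, Continuous fun t => F t y) (y₀ : E) :
    ∃ T : ℝ, 0 < T ∧ ∃ Y : ℝ → E, IsODESolution F y₀ (T : EReal) Y := by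
  obtain ⟨δ, hδ, h⟩ := exists_uniform_local_solution hF hFc 0 ‖y₀‖
  obtain ⟨Z, hZ0, hZ⟩ := h 0 (by simp) y₀ (by simp)
  rw [zero_add] at hZ
  have hsub : timeInterval (δ : EReal) ⊆ Icc 0 δ := fun s hs => by
    rw [mem_timeInterval_coe] at hs
    exact ⟨hs.1, hs.2.le⟩
  exact ⟨δ, hδ, Z, hZ0, fun t ht => (hZ t (hsub ht)).mono hsub⟩

/-- For each t take a solution living beyond t and evaluate it at t; uniqueness makes this diagonal
choice agree near t with one fixed solution. -/
theorem exists_maximal_odeSolution (hF : IsLocallyLipschitzField F) (y₀ : E)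
    (hpos : 0 < odeLifespan F y₀) : ∃ Y, IsODESolution F y₀ (odeLifespan F y₀) Y := by
  classical
  have hex : ∀ t ∈ timeInterval (odeLifespan F y₀),
      ∃ T : EReal, (t : EReal) < T ∧ ∃ Y : ℝ → E, IsODESolution F y₀ T Y := by
    intro t ht
    obtain ⟨T, ⟨_, hT⟩, htT⟩ := lt_sSup_iff.1 ht.2
    exact ⟨T, htT, hT⟩
  choose! τ hτ W hW using hex
  have hkey : ∀ t ∈ timeInterval (odeLifespan F y₀), ∀ s ∈ timeInterval (odeLifespan F y₀),
      (s : EReal) < τ t → W s s = W t s := by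
    intro t ht s hs hst
    have h1 := (hW s hs).mono (min_le_left (τ s) (τ t))
    have h2 := (hW t ht).mono (min_le_right (τ s) (τ t))
    exact h1.eqOn hF h2 ⟨hs.1, lt_min (hτ s hs) hst⟩
  refine ⟨fun t => W t t, (hW 0 (zero_mem_timeInterval hpos)).initial, fun t ht => ?_⟩
  have h1 := ((hW t ht).deriv t ⟨ht.1, hτ t ht⟩).mono_of_mem_nhdsWithin
    (timeInterval_mem_nhdsWithin (T := odeLifespan F y₀) (hτ t ht))
  refine h1.congr_of_eventuallyEq ?_ rfl
  filter_upwards [self_mem_nhdsWithin,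
    timeInterval_mem_nhdsWithin (T := odeLifespan F y₀) (hτ t ht)] with s hs hs'
  exact hkey t ht s hs hs'.2

/-- The local existence time δ depends only on R and the lifespan T₀. A norm below R at a time later
than T₀ - δ would therefore allow an extension past T₀. This gives a full limit, not merely
unboundedness. -/
theorem IsODESolution.tendsto_norm_atTop [CompleteSpace E] (hF : IsLocallyLipschitzField F)
    (hFc : ∀ y, Continuous fun t => F t y) (hY : IsODESolution F y₀ (odeLifespan F y₀) Y)
    (hpos : 0 < odeLifespan F y₀) (htop : odeLifespan F y₀ < ⊤) :
    Tendsto (fun t => ‖Y t‖) (𝓝[<] (odeLifespan F y₀).toReal) atTop := by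
  set T₀ := (odeLifespan F y₀).toReal with hT₀
  have hcoe : (T₀ : EReal) = odeLifespan F y₀ :=
    EReal.coe_toReal htop.ne (ne_bot_of_gt hpos)
  have hT₀pos : 0 < T₀ := by
    rw [← hcoe] at hpos
    exact_mod_cast hpos
  rw [Filter.tendsto_atTop]
  intro R
  obtain ⟨δ, hδ, hloc⟩ := exists_uniform_local_solution hF hFc T₀ R
  have hmem : Ioo (max 0 (T₀ - δ)) T₀ ∈ 𝓝[<] T₀ :=
    Ioo_mem_nhdsLT (max_lt hT₀pos (by linarith))
  filter_upwards [hmem] with t ht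
  by_contra hlt
  have h0 : 0 ≤ t := (le_max_left _ _).trans ht.1.le
  have htm : t ∈ timeInterval (odeLifespan F y₀) := by
    rw [← hcoe, mem_timeInterval_coe]
    exact ⟨h0, ht.2⟩
  obtain ⟨Z, hZ0, hZ⟩ := hloc t ⟨h0, ht.2.le⟩ (Y t) (by simpa using (not_le.1 hlt).le)
  have h1 : ((t + δ : ℝ) : EReal) ≤ odeLifespan F y₀ := by
    refine le_sSup ⟨?_, _, hY.extend htm hZ0 hZ⟩
    exact_mod_cast (by linarith : 0 < t + δ)
  rw [← hcoe, EReal.coe_le_coe_iff] at h1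
  have := (le_max_right 0 (T₀ - δ)).trans_lt ht.1
  linarith

end ODE

/-! ### Sobolev inequalities for compactly supported C¹ functions. -/

section SobolevTest

open scoped NNReal ENNReal

theorem lintegral_mul_sq_le {α : Type*} [MeasurableSpace α] {μ : Measure α} {f g : α → ℝ≥0∞}
    (hf : AEMeasurable f μ) (hg : AEMeasurable g μ) :
    (∫⁻ a, f a * g a ∂μ) ^ 2 ≤ (∫⁻ a, f a ^ 2 ∂μ) * ∫⁻ a, g a ^ 2 ∂μ := by
  have h := ENNReal.lintegral_mul_le_Lp_mul_Lq μ Real.HolderConjugate.two_two hf hg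
  simp only [Pi.mul_apply, ENNReal.rpow_ofNat] at h
  refine (pow_le_pow_left' h 2).trans (le_of_eq ?_)
  rw [mul_pow, ← ENNReal.rpow_natCast, ← ENNReal.rpow_natCast, ← ENNReal.rpow_mul,
    ← ENNReal.rpow_mul]
  norm_num

/-- The `L^q` norm is bounded on the unit ball of `H¹`, tested on compactly supported `C¹`
functions. -/
def SobolevBound (n : ℕ) (q : ℝ) : Prop :=
  ∃ C : ℝ≥0, ∀ u : Space n → ℝ, ContDiff ℝ 1 u → HasCompactSupport u →
    ∫⁻ x, ‖u x‖ₑ ^ 2 ≤ 1 → ∫⁻ x, ‖fderiv ℝ u x‖ₑ ^ 2 ≤ 1 → ∫⁻ x, ‖u x‖ₑ ^ q ≤ C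

/-- Pointwise x^q ≤ x² + x^r, according to whether x ≤ 1 or x ≥ 1. -/
theorem SobolevBound.interpolate {n : ℕ} {q r : ℝ} (hq : 2 ≤ q) (hqr : q ≤ r)
    (h : SobolevBound n r) : SobolevBound n q := by
  obtain ⟨C, hC⟩ := h
  refine ⟨1 + C, fun u hu hc h1 h2 => ?_⟩
  have h3 : ∀ x : ℝ≥0∞, x ^ q ≤ x ^ 2 + x ^ r := by
    intro x
    rcases le_total x 1 with hx | hx
    · refine le_add_of_le_left ?_
      rw [← ENNReal.rpow_natCast]
      exact ENNReal.rpow_le_rpow_of_exponent_ge hx (by exact_mod_cast hq)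
    · exact le_add_of_le_right (ENNReal.rpow_le_rpow_of_exponent_le hx hqr)
  calc ∫⁻ x, ‖u x‖ₑ ^ q ≤ ∫⁻ x, (‖u x‖ₑ ^ 2 + ‖u x‖ₑ ^ r) := lintegral_mono fun x => h3 _
    _ = (∫⁻ x, ‖u x‖ₑ ^ 2) + ∫⁻ x, ‖u x‖ₑ ^ r :=
      lintegral_add_left (hu.continuous.enorm.measurable.pow_const 2) _
    _ ≤ 1 + C := add_le_add h1 (hC u hu hc h1 h2)
    _ = ((1 + C : ℝ≥0) : ℝ≥0∞) := by simp

/-- This is the endpoint Gagliardo-Nirenberg-Sobolev inequality, with 1/r = 1/2 - 1/n. -/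
theorem sobolevBound_of_three_le {n : ℕ} (hn : 3 ≤ n) :
    SobolevBound n (2 * n / (n - 2)) := by
  have hn' : (3 : ℝ) ≤ n := by exact_mod_cast hn
  have hr : (0 : ℝ) < 2 * n / (n - 2) := by
    apply div_pos <;> linarith
  set r : ℝ≥0 := ⟨2 * n / (n - 2), hr.le⟩ with hrdef
  have hr0 : r ≠ 0 := fun h => hr.ne' (congrArg NNReal.toReal h)
  set C := SNormLESNormFDerivOfEqConst ℝ (volume : Measure (Space n)) ((2 : ℝ≥0) : ℝ)
  refine ⟨C ^ (r : ℝ), fun u hu hc h1 h2 => ?_⟩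
  have h := eLpNorm_le_eLpNorm_fderiv_of_eq (volume : Measure (Space n)) hu hc (p := 2) (p' := r)
    (by norm_num) (by simp; omega) (by
      have : (n : ℝ) - 2 ≠ 0 := by linarith
      have hr' : (r : ℝ) = 2 * n / (n - 2) := rfl
      simp only [hr', finrank_euclideanSpace, Fintype.card_fin]
      push_cast
      field_simp)
  have h4 : eLpNorm (fderiv ℝ u) ((2 : ℝ≥0) : ℝ≥0∞) volume ≤ 1 := by
    have h5 := eLpNorm_nnreal_pow_eq_lintegral (μ := volume) (f := fderiv ℝ u)
      (p := 2) (by norm_num)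
    have h6 : eLpNorm (fderiv ℝ u) ((2 : ℝ≥0) : ℝ≥0∞) volume ^ 2 ≤ 1 := by
      have h7 : ((2 : ℝ≥0) : ℝ) = ((2 : ℕ) : ℝ) := by norm_num
      rw [h7] at h5
      simp only [ENNReal.rpow_natCast] at h5
      rw [h5]
      exact h2
    exact (pow_le_one_iff (by norm_num)).1 h6
  have h8 := eLpNorm_nnreal_pow_eq_lintegral (μ := volume) (f := u) hr0
  change ∫⁻ x, ‖u x‖ₑ ^ (r : ℝ) ≤ _
  rw [← h8, ENNReal.coe_rpow_of_nonneg _ r.coe_nonneg]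
  refine ENNReal.rpow_le_rpow (h.trans ?_) hr.le
  calc (C : ℝ≥0∞) * eLpNorm (fderiv ℝ u) ((2 : ℝ≥0) : ℝ≥0∞) volume ≤ C * 1 := by gcongr
    _ = C := mul_one _

theorem enorm_fderiv_pow {n : ℕ} {u : Space n → ℝ} (hu : ContDiff ℝ 1 u) (k : ℕ) (x : Space n) :
    ‖fderiv ℝ (fun y => u y ^ (k + 1)) x‖ₑ = (k + 1) * (‖u x‖ₑ ^ k * ‖fderiv ℝ u x‖ₑ) := by
  rw [fderiv_fun_pow (k + 1) (hu.differentiable (by norm_num) x), enorm_smul, Nat.add_sub_cancel,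
    nsmul_eq_mul, enorm_mul, enorm_pow, mul_assoc]
  congr 1
  rw [Real.enorm_natCast]
  push_cast
  rfl

/-- The critical exponent is infinite in the plane, so even powers are reached by induction. The
planar inequality ‖w‖₂ ≲ ‖∇w‖₁ is applied to w = u^{k+2}, whose gradient is (k+2) u^{k+1} ∇u;
Cauchy-Schwarz leaves the previous power times ‖∇u‖₂². -/
theorem lintegral_pow_two_dim (k : ℕ) :
    ∃ C : ℝ≥0, ∀ u : Space 2 → ℝ, ContDiff ℝ 1 u → HasCompactSupport u →
      ∫⁻ x, ‖u x‖ₑ ^ 2 ≤ 1 → ∫⁻ x, ‖fderiv ℝ u x‖ₑ ^ 2 ≤ 1 →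
      ∫⁻ x, ‖u x‖ₑ ^ (2 * (k + 1)) ≤ C := by
  induction k with
  | zero => exact ⟨1, fun u _ _ h _ => by simpa using h⟩
  | succ k ih =>
    obtain ⟨C, hC⟩ := ih
    set M := lintegralPowLePowLIntegralFDerivConst (volume : Measure (Space 2)) (2 : ℝ)
    refine ⟨M * ((k + 2) ^ 2 * C), fun u hu hc h1 h2 => ?_⟩
    have h3 := lintegral_pow_le_pow_lintegral_fderiv (volume : Measure (Space 2))
      (u := fun y => u y ^ (k + 1 + 1)) (hu.pow _) (hc.comp_left (g := fun z => z ^ (k + 1 + 1))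
      (by simp)) (p := 2) (by simpa using Real.HolderConjugate.two_two)
    simp only [enorm_fderiv_pow hu, ENNReal.rpow_ofNat, enorm_pow, ← pow_mul] at h3
    have hmeas : AEMeasurable (fun x => ‖u x‖ₑ ^ (k + 1)) :=
      (hu.continuous.enorm.measurable.pow_const _).aemeasurable
    have hmeas' : AEMeasurable (fun x => ‖fderiv ℝ u x‖ₑ) :=
      (hu.continuous_fderiv (by norm_num)).enorm.measurable.aemeasurable
    rw [lintegral_const_mul' _ _ (by simp), mul_pow] at h3
    have h4 := lintegral_mul_sq_le hmeas hmeas'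
    simp only [← pow_mul] at h4
    have h5 : (∫⁻ x, ‖u x‖ₑ ^ (k + 1) * ‖fderiv ℝ u x‖ₑ) ^ 2 ≤ C * 1 := by
      refine h4.trans (mul_le_mul' ?_ h2)
      rw [mul_comm]
      exact hC u hu hc h1 h2
    rw [mul_comm 2]
    refine h3.trans ?_
    push_cast
    rw [mul_one] at h5
    have h6 : ((k : ℝ≥0∞) + 1 + 1) = k + 2 := by rw [add_assoc]; norm_num
    rw [h6]
    gcongr

theorem sobolevBound_two {q : ℝ} (hq : 2 ≤ q) : SobolevBound 2 q := by
  obtain ⟨k, hk⟩ := exists_nat_ge q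
  obtain ⟨C, hC⟩ := lintegral_pow_two_dim k
  refine SobolevBound.interpolate (r := ((2 * (k + 1) : ℕ) : ℝ)) hq (by push_cast; linarith) ?_
  exact ⟨C, by simpa only [ENNReal.rpow_natCast] using hC⟩

/-- The fundamental theorem of calculus on a half-line, transported along a measure-preserving
isometry between ℝ and `Space 1`. -/
theorem enorm_le_lintegral_fderiv_one_dim {u : Space 1 → ℝ} (hu : ContDiff ℝ 1 u)
    (hc : HasCompactSupport u) (x : Space 1) : ‖u x‖ₑ ≤ ∫⁻ y, ‖fderiv ℝ u y‖ₑ := by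
  let γ : ℝ ≃ₗᵢ[ℝ] Space 1 := (stdOrthonormalBasis ℝ ℝ).equiv (EuclideanSpace.basisFun (Fin 1) ℝ)
    (finCongr (by simp))
  have hγ : MeasurePreserving γ := γ.measurePreserving
  have h1 := HasCompactSupport.enorm_le_lintegral_Ici_deriv (f := u ∘ γ)
    (hu.comp γ.contDiff) (hc.comp_homeomorph γ.toHomeomorph) (γ.symm x)
  have h2 : ∀ y, ‖deriv (u ∘ γ) y‖ₑ ≤ ‖fderiv ℝ u (γ y)‖ₑ := by
    intro y
    have h3 : HasDerivAt (u ∘ γ) (fderiv ℝ u (γ y) (γ 1)) y := by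
      refine (hu.differentiable (by norm_num) (γ y)).hasFDerivAt.comp_hasDerivAt y ?_
      have := (γ : ℝ →L[ℝ] Space 1).hasDerivAt (x := y)
      exact this
    rw [h3.deriv]
    refine enorm_le_iff_norm_le.2 ((ContinuousLinearMap.le_opNorm _ _).trans ?_)
    simp
  simp only [Function.comp_apply, LinearIsometryEquiv.apply_symm_apply] at h1
  calc ‖u x‖ₑ ≤ ∫⁻ y in Iic (γ.symm x), ‖deriv (u ∘ γ) y‖ₑ := h1
    _ ≤ ∫⁻ y, ‖deriv (u ∘ γ) y‖ₑ := setLIntegral_le_lintegral _ _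
    _ ≤ ∫⁻ y, ‖fderiv ℝ u (γ y)‖ₑ := lintegral_mono h2
    _ = ∫⁻ y, ‖fderiv ℝ u y‖ₑ :=
      hγ.lintegral_comp (hu.continuous_fderiv (by norm_num)).enorm.measurable

theorem sobolevBound_one {q : ℝ} (hq : 2 ≤ q) : SobolevBound 1 q := by
  refine ⟨4 ^ ((q - 2) / 4), fun u hu hc h1 h2 => ?_⟩
  -- Applied to u², the one-dimensional bound gives |u|² ≤ 2∫|u||u'|; squaring and Cauchy-Schwarz
  -- produce the 4.
  have hsup : ∀ x, ‖u x‖ₑ ^ 4 ≤ 4 := by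
    intro x
    have h3 := enorm_le_lintegral_fderiv_one_dim (u := fun y => u y ^ (1 + 1)) (hu.pow _)
      (hc.comp_left (g := fun z => z ^ (1 + 1)) (by simp)) x
    have hmeas : AEMeasurable (fun x => ‖u x‖ₑ) := hu.continuous.enorm.measurable.aemeasurable
    have hmeas' : AEMeasurable (fun x => ‖fderiv ℝ u x‖ₑ) :=
      (hu.continuous_fderiv (by norm_num)).enorm.measurable.aemeasurable
    simp only [enorm_fderiv_pow hu, enorm_pow, pow_one] at h3
    rw [lintegral_const_mul' _ _ (by simp)] at h3
    have h4 := lintegral_mul_sq_le hmeas hmeas'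
    have h5 := pow_le_pow_left' h3 2
    rw [mul_pow, ← pow_mul] at h5
    calc ‖u x‖ₑ ^ 4 ≤ _ := h5
      _ ≤ ((1 : ℕ) + 1) ^ 2 * (1 * 1) := by gcongr; exact h4.trans (mul_le_mul' h1 h2)
      _ = 4 := by norm_num
  have h6 : ∀ x, ‖u x‖ₑ ^ q ≤ 4 ^ ((q - 2) / 4) * ‖u x‖ₑ ^ 2 := by
    intro x
    have h7 : ‖u x‖ₑ ^ q = (‖u x‖ₑ ^ 4) ^ ((q - 2) / 4) * ‖u x‖ₑ ^ 2 := by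
      rw [← ENNReal.rpow_natCast, ← ENNReal.rpow_natCast, ← ENNReal.rpow_mul,
        ← ENNReal.rpow_add_of_nonneg _ _ (by push_cast; linarith) (by norm_num)]
      congr 1
      push_cast
      ring
    rw [h7]
    gcongr
    exact hsup x
  calc ∫⁻ x, ‖u x‖ₑ ^ q ≤ ∫⁻ x, 4 ^ ((q - 2) / 4) * ‖u x‖ₑ ^ 2 := lintegral_mono h6
    _ = 4 ^ ((q - 2) / 4) * ∫⁻ x, ‖u x‖ₑ ^ 2 :=
      lintegral_const_mul _ (hu.continuous.enorm.measurable.pow_const 2)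
    _ ≤ 4 ^ ((q - 2) / 4) * 1 := by gcongr
    _ = _ := by
      rw [mul_one, ENNReal.coe_rpow_of_nonneg _ (by linarith)]
      norm_num

theorem sobolevBound {n : ℕ} (hn : 1 ≤ n) {q : ℝ} (hq : 2 ≤ q)
    (hqn : 3 ≤ n → q ≤ 2 * n / (n - 2)) : SobolevBound n q := by
  rcases lt_or_ge n 3 with h | h
  · interval_cases n
    · exact sobolevBound_one hq
    · exact sobolevBound_two hq
  · exact (sobolevBound_of_three_le h).interpolate hq (hqn h)

end SobolevTest

/-! ### Approximation of H¹ functions by mollification and cutoff. -/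

section Mollification

open ContinuousLinearMap
open scoped NNReal ENNReal Convolution

variable {n : ℕ} {F : Type*} [NormedAddCommGroup F] [NormedSpace ℝ F]

theorem convolution_lsmul_apply (ρ : Space n → ℝ) (g : Space n → F) (x : Space n) :
    (ρ ⋆[lsmul ℝ ℝ, volume] g) x = ∫ t, ρ (x - t) • g t := by
  rw [convolution_eq_swap]
  rfl

/-- Young's inequality L¹ * L² ⊂ L²: split |ρ| as a product of two square roots, apply
Cauchy-Schwarz, then Tonelli. -/
theorem lintegral_convolution_sq_le {ρ : Space n → ℝ} (hρ : Continuous ρ)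
    (h1 : ∫⁻ x, ‖ρ x‖ₑ = 1) {g : Space n → F} (hg : StronglyMeasurable g) :
    ∫⁻ x, ‖(ρ ⋆[lsmul ℝ ℝ, volume] g) x‖ₑ ^ 2 ≤ ∫⁻ x, ‖g x‖ₑ ^ 2 := by
  have hmeas : Measurable fun z : Space n × Space n => ‖ρ (z.1 - z.2)‖ₑ * ‖g z.2‖ₑ ^ 2 :=
    (hρ.enorm.measurable.comp (measurable_fst.sub measurable_snd)).mul
      ((hg.enorm.comp measurable_snd).pow_const 2)
  have hpt : ∀ x, ‖(ρ ⋆[lsmul ℝ ℝ, volume] g) x‖ₑ ^ 2 ≤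
      ∫⁻ t, ‖ρ (x - t)‖ₑ * ‖g t‖ₑ ^ 2 := by
    intro x
    have hr : Measurable fun t => ‖ρ (x - t)‖ₑ ^ (1 / 2 : ℝ) :=
      (hρ.enorm.measurable.comp (measurable_const.sub measurable_id)).pow_const _
    have hsq : ∀ a : ℝ≥0∞, (a ^ (1 / 2 : ℝ)) ^ 2 = a := fun a => by
      rw [← ENNReal.rpow_natCast, ← ENNReal.rpow_mul]
      norm_num
    have h2 : ‖(ρ ⋆[lsmul ℝ ℝ, volume] g) x‖ₑ ≤
        ∫⁻ t, ‖ρ (x - t)‖ₑ ^ (1 / 2 : ℝ) * (‖ρ (x - t)‖ₑ ^ (1 / 2 : ℝ) * ‖g t‖ₑ) := by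
      rw [convolution_lsmul_apply]
      refine (enorm_integral_le_lintegral_enorm _).trans (le_of_eq (lintegral_congr fun t => ?_))
      rw [enorm_smul, ← mul_assoc, ← sq, hsq]
    refine (pow_le_pow_left' h2 2).trans ((lintegral_mul_sq_le hr.aemeasurable
      (hr.mul hg.enorm).aemeasurable).trans (le_of_eq ?_))
    simp only [Pi.mul_apply, mul_pow, hsq]
    rw [lintegral_sub_left_eq_self (fun t => ‖ρ t‖ₑ) x, h1, one_mul]
  calc ∫⁻ x, ‖(ρ ⋆[lsmul ℝ ℝ, volume] g) x‖ₑ ^ 2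
      ≤ ∫⁻ x, ∫⁻ t, ‖ρ (x - t)‖ₑ * ‖g t‖ₑ ^ 2 := lintegral_mono hpt
    _ = ∫⁻ t, ∫⁻ x, ‖ρ (x - t)‖ₑ * ‖g t‖ₑ ^ 2 := lintegral_lintegral_swap hmeas.aemeasurable
    _ = ∫⁻ t, ‖g t‖ₑ ^ 2 := by
      refine lintegral_congr fun t => ?_
      rw [lintegral_mul_const' _ _ (by simp),
        lintegral_sub_right_eq_self (fun x => ‖ρ x‖ₑ) t, h1, one_mul]

/-- The derivative falls on ρ. As t ↦ ρ(x - t) is itself a test function, the definition of the weak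
gradient moves the derivative to f; the two minus signs cancel. -/
theorem fderiv_convolution_of_isWeakGrad {ρ : Space n → ℝ} (hρ : ContDiff ℝ ∞ ρ)
    (hc : HasCompactSupport ρ) {f : Space n → ℝ} {g : Space n → Space n}
    (hf : LocallyIntegrable f) (hg : LocallyIntegrable g) (h : IsWeakGrad f g) (x : Space n) :
    fderiv ℝ (ρ ⋆[lsmul ℝ ℝ, volume] f) x = innerSL ℝ ((ρ ⋆[lsmul ℝ ℝ, volume] g) x) := by
  rw [(hc.hasFDerivAt_convolution_left (lsmul ℝ ℝ) (hρ.of_le (by norm_cast)) hf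
    x).fderiv]
  refine ContinuousLinearMap.coe_injective
    ((EuclideanSpace.basisFun (Fin n) ℝ).toBasis.ext fun i => ?_)
  have hφc : HasCompactSupport fun t => ρ (x - t) := hc.comp_homeomorph (Homeomorph.subLeft x)
  have hφ : ContDiff ℝ ∞ fun t => ρ (x - t) := hρ.comp (contDiff_const.sub contDiff_id)
  have hφd : ∀ t, fderiv ℝ (fun t => ρ (x - t)) t = -fderiv ℝ ρ (x - t) := by
    intro t
    have h1 : HasFDerivAt (fun t => ρ (x - t))
        ((fderiv ℝ ρ (x - t)).comp (-ContinuousLinearMap.id ℝ (Space n))) t :=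
      (hρ.differentiable (by simp) (x - t)).hasFDerivAt.comp t ((hasFDerivAt_id t).const_sub x)
    rw [h1.fderiv]
    ext v
    simp
  have hint : Integrable fun t =>
      (precompL (Space n) (lsmul ℝ ℝ : ℝ →L[ℝ] ℝ →L[ℝ] ℝ)) (fderiv ℝ ρ (x - t)) (f t) :=
    ((hc.fderiv (𝕜 := ℝ)).convolutionExists_left _ (hρ.continuous_fderiv (by simp)) hf
      x).integrable_swap
  have hint' : Integrable fun t => ρ (x - t) • g t :=
    hg.integrable_smul_left_of_hasCompactSupport hφ.continuous hφc
  have hw := h _ hφ hφc i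
  simp only [hφd] at hw
  simp only [OrthonormalBasis.coe_toBasis, EuclideanSpace.basisFun_apply, coe_coe]
  rw [convolution_eq_swap, ContinuousLinearMap.integral_apply hint, innerSL_apply_apply,
    convolution_lsmul_apply, EuclideanSpace.inner_single_right]
  have h2 : (∫ t, ρ (x - t) • g t) i = ∫ t, g t i * ρ (x - t) := by
    have := (EuclideanSpace.proj i : Space n →L[ℝ] ℝ).integral_comp_comm hint'
    refine this.symm.trans ?_
    refine integral_congr_ae (Eventually.of_forall fun t => ?_)
    simp [mul_comm]
  rw [h2]
  simp only [ContinuousLinearMap.precompL_apply]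
  have h3 : ∫ t, f t * (-fderiv ℝ ρ (x - t)) (EuclideanSpace.single i 1) =
      -∫ t, (lsmul ℝ ℝ : ℝ →L[ℝ] ℝ →L[ℝ] ℝ) (fderiv ℝ ρ (x - t) (EuclideanSpace.single i 1)) (f t) := by
    rw [← integral_neg]
    refine integral_congr_ae (Eventually.of_forall fun t => ?_)
    simp [mul_comm]
  rw [h3, neg_inj] at hw
  rw [hw]
  simp

/-- Smooth cutoff functions, equal to `1` on larger and larger balls, with uniformly bounded
gradient. -/
theorem exists_cutoff (n : ℕ) : ∃ (M : ℝ≥0) (χ : ℕ → Space n → ℝ), (∀ k, ContDiff ℝ ∞ (χ k)) ∧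
    (∀ k, HasCompactSupport (χ k)) ∧ (∀ k x, ‖χ k x‖ ≤ 1) ∧ (∀ k x, ‖fderiv ℝ (χ k) x‖ ≤ M) ∧
    ∀ x, ∀ᶠ k in atTop, χ k x = 1 := by
  let ψ : ContDiffBump (0 : Space n) := ⟨1, 2, one_pos, one_lt_two⟩
  have hψ : ContDiff ℝ ∞ ψ := ψ.contDiff
  obtain ⟨M, hM⟩ := (ψ.hasCompactSupport.fderiv (𝕜 := ℝ)).exists_bound_of_continuous
    (hψ.continuous_fderiv (by simp))
  have hc : ∀ k : ℕ, (1 / ((k : ℝ) + 1)) ≠ 0 := fun k => by positivity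
  refine ⟨⟨M, (norm_nonneg _).trans (hM 0)⟩, fun k x => ψ ((1 / ((k : ℝ) + 1)) • x),
    fun k => hψ.comp (contDiff_id.const_smul _), fun k => ?_, fun k x => ?_, fun k x => ?_,
    fun x => ?_⟩
  · exact ψ.hasCompactSupport.comp_homeomorph (Homeomorph.smulOfNeZero _ (hc k))
  · rw [Real.norm_of_nonneg ψ.nonneg]
    exact ψ.le_one
  · rw [fderiv_comp_smul, norm_smul]
    refine (mul_le_of_le_one_left (norm_nonneg _) ?_).trans (hM _)
    rw [Real.norm_of_nonneg (by positivity), div_le_one (by positivity)]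
    linarith [k.cast_nonneg (α := ℝ)]
  · obtain ⟨N, hN⟩ := exists_nat_ge ‖x‖
    filter_upwards [eventually_ge_atTop N] with k hk
    refine ψ.one_of_mem_closedBall ?_
    rw [mem_closedBall_zero_iff, norm_smul, Real.norm_of_nonneg (by positivity), one_div,
      inv_mul_le_iff₀ (by positivity)]
    change ‖x‖ ≤ ((k : ℝ) + 1) * 1
    have : (N : ℝ) ≤ k := by exact_mod_cast hk
    linarith

theorem enorm_add_sq_le {G : Type*} [SeminormedAddCommGroup G] (a b : G) :
    ‖a + b‖ₑ ^ 2 ≤ 2 * ‖a‖ₑ ^ 2 + 2 * ‖b‖ₑ ^ 2 := by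
  have h : ‖a + b‖₊ ^ 2 ≤ 2 * ‖a‖₊ ^ 2 + 2 * ‖b‖₊ ^ 2 := by
    have h1 := nnnorm_add_le a b
    have h2 := add_pow_le (zero_le (a := ‖a‖₊)) (zero_le (a := ‖b‖₊)) 2
    calc ‖a + b‖₊ ^ 2 ≤ (‖a‖₊ + ‖b‖₊) ^ 2 := by gcongr
      _ ≤ _ := h2
      _ = _ := by ring
  simp only [enorm_eq_nnnorm]
  exact_mod_cast h

/-- Approximation of an `H¹` function by compactly supported smooth functions, bounded in `H¹` and
converging almost everywhere. -/
theorem exists_smooth_approx (n : ℕ) : ∃ M : ℝ≥0, ∀ (f : L2 n) (g : L2Vec n), IsWeakGrad f g →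
    ∃ u : ℕ → Space n → ℝ, (∀ k, ContDiff ℝ 1 (u k)) ∧ (∀ k, HasCompactSupport (u k)) ∧
      (∀ k, ∫⁻ x, ‖u k x‖ₑ ^ 2 ≤ ∫⁻ x, ‖f x‖ₑ ^ 2) ∧
      (∀ k, ∫⁻ x, ‖fderiv ℝ (u k) x‖ₑ ^ 2 ≤
        2 * (∫⁻ x, ‖g x‖ₑ ^ 2) + 2 * (M ^ 2 * ∫⁻ x, ‖f x‖ₑ ^ 2)) ∧
      ∀ᵐ x, Tendsto (fun k => u k x) atTop (𝓝 (f x)) := by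
  obtain ⟨M, χ, hχ, hχc, hχ1, hχM, hχt⟩ := exists_cutoff n
  refine ⟨M, fun f g h => ?_⟩
  -- The ratio 2 of outer to inner radius is independent of k, as the almost everywhere convergence
  -- of the mollifications requires.
  let φ : ℕ → ContDiffBump (0 : Space n) := fun k =>
    ⟨1 / ((k : ℝ) + 1), 2 * (1 / ((k : ℝ) + 1)), by positivity, by
      have : (0 : ℝ) < 1 / ((k : ℝ) + 1) := by positivity
      linarith⟩
  let ρ : ℕ → Space n → ℝ := fun k => (φ k).normed volume
  have hρ : ∀ k, ContDiff ℝ ∞ (ρ k) := fun k => (φ k).contDiff_normed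
  have hρc : ∀ k, HasCompactSupport (ρ k) := fun k => (φ k).hasCompactSupport_normed
  have hρ1 : ∀ k, ∫⁻ x, ‖ρ k x‖ₑ = 1 := by
    intro k
    have h1 := ofReal_integral_eq_lintegral_ofReal (μ := volume) (φ k).integrable_normed
      (Eventually.of_forall fun x => (φ k).nonneg_normed x)
    rw [(φ k).integral_normed, ENNReal.ofReal_one] at h1
    rw [h1]
    exact lintegral_congr fun x => Real.enorm_of_nonneg ((φ k).nonneg_normed x)
  have hf : LocallyIntegrable f := (Lp.memLp f).locallyIntegrable (by norm_num)
  have hg : LocallyIntegrable g := (Lp.memLp g).locallyIntegrable (by norm_num)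
  set v : ℕ → Space n → ℝ := fun k => ρ k ⋆[lsmul ℝ ℝ, volume] f with hv
  have hvs : ∀ k, ContDiff ℝ ∞ (v k) := fun k =>
    (hρc k).contDiff_convolution_left (lsmul ℝ ℝ) (hρ k) hf
  have hvd : ∀ k x, fderiv ℝ (v k) x = innerSL ℝ ((ρ k ⋆[lsmul ℝ ℝ, volume] g) x) := fun k x =>
    fderiv_convolution_of_isWeakGrad (hρ k) (hρc k) hf hg h x
  have hv2 : ∀ k, ∫⁻ x, ‖v k x‖ₑ ^ 2 ≤ ∫⁻ x, ‖f x‖ₑ ^ 2 := fun k =>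
    lintegral_convolution_sq_le (hρ k).continuous (hρ1 k) (Lp.stronglyMeasurable f)
  have hvd2 : ∀ k, ∫⁻ x, ‖fderiv ℝ (v k) x‖ₑ ^ 2 ≤ ∫⁻ x, ‖g x‖ₑ ^ 2 := by
    intro k
    refine le_trans (le_of_eq (lintegral_congr fun x => ?_))
      (lintegral_convolution_sq_le (hρ k).continuous (hρ1 k) (Lp.stronglyMeasurable g))
    rw [hvd]
    congr 1
    rw [enorm_eq_iff_norm_eq, innerSL_apply_norm]
  have hχ1' : ∀ k x, ‖χ k x‖ₑ ≤ 1 := fun k x => by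
    have := hχ1 k x
    rw [enorm_eq_nnnorm]
    exact_mod_cast this
  have hχM' : ∀ k x, ‖fderiv ℝ (χ k) x‖ₑ ≤ M := fun k x => by
    have := hχM k x
    rw [enorm_eq_nnnorm]
    exact_mod_cast this
  refine ⟨fun k x => χ k x * v k x, fun k => ?_, fun k => (hχc k).mul_right, fun k => ?_,
    fun k => ?_, ?_⟩
  · exact ((hχ k).mul (hvs k)).of_le (by norm_cast)
  · refine le_trans (lintegral_mono fun x => ?_) (hv2 k)
    rw [enorm_mul]
    gcongr
    exact mul_le_of_le_one_left' (hχ1' k x)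
  · have hd : ∀ x, fderiv ℝ (fun x => χ k x * v k x) x =
        χ k x • fderiv ℝ (v k) x + v k x • fderiv ℝ (χ k) x := fun x =>
      fderiv_fun_mul ((hχ k).differentiable (by simp) x) ((hvs k).differentiable (by simp) x)
    calc ∫⁻ x, ‖fderiv ℝ (fun x => χ k x * v k x) x‖ₑ ^ 2
        ≤ ∫⁻ x, (2 * ‖fderiv ℝ (v k) x‖ₑ ^ 2 + 2 * (M ^ 2 * ‖v k x‖ₑ ^ 2)) := by
          refine lintegral_mono fun x => ?_
          rw [hd]
          refine (enorm_add_sq_le _ _).trans ?_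
          rw [enorm_smul, enorm_smul, ← mul_pow]
          refine add_le_add (mul_le_mul' le_rfl (pow_le_pow_left' ?_ 2))
            (mul_le_mul' le_rfl (pow_le_pow_left' ?_ 2))
          · exact mul_le_of_le_one_left' (hχ1' k x)
          · exact (mul_comm _ _).trans_le (mul_le_mul' (hχM' k x) le_rfl)
      _ = 2 * (∫⁻ x, ‖fderiv ℝ (v k) x‖ₑ ^ 2) + 2 * (M ^ 2 * ∫⁻ x, ‖v k x‖ₑ ^ 2) := by
          have m1 : Measurable fun x => ‖fderiv ℝ (v k) x‖ₑ ^ 2 :=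
            ((hvs k).continuous_fderiv (by simp)).enorm.measurable.pow_const 2
          have m2 : Measurable fun x => ‖v k x‖ₑ ^ 2 :=
            (hvs k).continuous.enorm.measurable.pow_const 2
          rw [lintegral_add_left (m1.const_mul 2), lintegral_const_mul _ m1,
            lintegral_const_mul _ (m2.const_mul _), lintegral_const_mul _ m2]
      _ ≤ _ := by
          exact add_le_add (mul_le_mul' le_rfl (hvd2 k))
            (mul_le_mul' le_rfl (mul_le_mul' le_rfl (hv2 k)))
  · have hlim : Tendsto (fun k : ℕ => 2 * (1 / ((k : ℝ) + 1))) atTop (𝓝 0) := by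
      simpa using tendsto_one_div_add_atTop_nhds_zero_nat.const_mul (2 : ℝ)
    filter_upwards [ContDiffBump.ae_convolution_tendsto_right_of_locallyIntegrable (φ := φ) (K := 2)
      hlim (Eventually.of_forall fun k => le_rfl) hf] with x hx
    refine Tendsto.congr' ?_ hx
    filter_upwards [hχt x] with k hk
    rw [hk, one_mul]

end Mollification

/-! ### Passage of the Sobolev bound to H¹ by Fatou's lemma. -/

section SobolevEmbedding

open scoped NNReal ENNReal

variable {n : ℕ}

theorem lintegral_enorm_sq_eq {F : Type*} [NormedAddCommGroup F]
    (f : Lp F 2 (volume : Measure (Space n))) :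
    ∫⁻ x, ‖f x‖ₑ ^ 2 = ‖f‖ₑ ^ 2 := by
  rw [Lp.enorm_def, eLpNorm_eq_lintegral_rpow_enorm_toReal (by norm_num) (by norm_num),
    ← ENNReal.rpow_natCast, ← ENNReal.rpow_mul]
  norm_num

theorem norm_sq_H1 (w : H1 n) : ‖w‖ ^ 2 = ‖toL2 n w‖ ^ 2 + ‖grad n w‖ ^ 2 :=
  WithLp.prod_norm_sq_eq_of_L2 (w : WithLp 2 (L2 n × L2Vec n))

theorem norm_toL2_le (w : H1 n) : ‖toL2 n w‖ ≤ ‖w‖ := by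
  have := norm_sq_H1 w
  nlinarith [norm_nonneg (toL2 n w), norm_nonneg w, sq_nonneg ‖grad n w‖]

theorem norm_grad_le (w : H1 n) : ‖grad n w‖ ≤ ‖w‖ := by
  have := norm_sq_H1 w
  nlinarith [norm_nonneg (grad n w), norm_nonneg w, sq_nonneg ‖toL2 n w‖]

theorem exists_lintegral_rpow_le {q : ℝ} (h : SobolevBound n q) :
    ∃ C : ℝ≥0, ∃ c : ℝ, 0 < c ∧ ∀ w : H1 n, ‖w‖ ≤ c → ∫⁻ x, ‖toL2 n w x‖ₑ ^ q ≤ C := by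
  obtain ⟨C, hC⟩ := h
  obtain ⟨M, hM⟩ := exists_smooth_approx n
  -- This radius makes 2c² + 2M²c² ≤ 1, so the approximants meet the normalization in
  -- `SobolevBound`.
  set c : ℝ≥0 := (2 + 2 * M)⁻¹ with hc
  refine ⟨C, c, by positivity, fun w hw => ?_⟩
  obtain ⟨u, hu, huc, hu2, hud, hut⟩ := hM (toL2 n w) (grad n w) w.2
  simp only [lintegral_enorm_sq_eq] at hu2 hud
  have hbound : ∀ k, ∫⁻ x, ‖u k x‖ₑ ^ q ≤ C := by
    have hf : ‖toL2 n w‖₊ ≤ c := NNReal.coe_le_coe.1 ((norm_toL2_le w).trans hw)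
    have hg : ‖grad n w‖₊ ≤ c := NNReal.coe_le_coe.1 ((norm_grad_le w).trans hw)
    have hc' : c * (2 + 2 * M) = 1 := inv_mul_cancel₀ (by positivity)
    have hcsq : c ^ 2 * (2 + 2 * M) ^ 2 = 1 := by rw [← mul_pow, hc', one_pow]
    intro k
    refine hC (u k) (hu k) (huc k) ((hu2 k).trans ?_) ((hud k).trans ?_)
    · rw [enorm_eq_nnnorm]
      have : ‖toL2 n w‖₊ ^ 2 ≤ 1 := by
        calc ‖toL2 n w‖₊ ^ 2 ≤ c ^ 2 * 1 := by rw [mul_one]; gcongr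
          _ ≤ c ^ 2 * (2 + 2 * M) ^ 2 := by
            gcongr
            exact one_le_pow₀ (le_add_of_le_left (by norm_num))
          _ = 1 := hcsq
      exact_mod_cast this
    · rw [enorm_eq_nnnorm, enorm_eq_nnnorm]
      have : 2 * ‖grad n w‖₊ ^ 2 + 2 * (M ^ 2 * ‖toL2 n w‖₊ ^ 2) ≤ 1 := by
        calc 2 * ‖grad n w‖₊ ^ 2 + 2 * (M ^ 2 * ‖toL2 n w‖₊ ^ 2)
            ≤ 2 * c ^ 2 + 2 * (M ^ 2 * c ^ 2) := by gcongr
          _ ≤ 2 * c ^ 2 + 2 * (M ^ 2 * c ^ 2) + c ^ 2 * (2 + 8 * M + 2 * M ^ 2) :=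
            le_self_add
          _ = c ^ 2 * (2 + 2 * M) ^ 2 := by ring
          _ = 1 := hcsq
      exact_mod_cast this
  calc ∫⁻ x, ‖toL2 n w x‖ₑ ^ q = ∫⁻ x, liminf (fun k => ‖u k x‖ₑ ^ q) atTop := by
        refine lintegral_congr_ae ?_
        filter_upwards [hut] with x hx
        exact (((ENNReal.continuous_rpow_const.tendsto _).comp
          ((continuous_enorm.tendsto _).comp hx)).liminf_eq).symm
    _ ≤ liminf (fun k => ∫⁻ x, ‖u k x‖ₑ ^ q) atTop :=
      lintegral_liminf_le fun k => (hu k).continuous.enorm.measurable.pow_const q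
    _ ≤ C := by
      refine liminf_le_of_le (by isBoundedDefault) fun b hb => ?_
      obtain ⟨k, hk⟩ := hb.exists
      exact hk.trans (hbound k)

end SobolevEmbedding

/-! ### The nonlinearity as a locally Lipschitz map from H¹ to L². -/

section Nemytskii

open scoped NNReal ENNReal

variable {n : ℕ}

/-- The Sobolev embedding `H¹(ℝⁿ) ⊆ L^q(ℝⁿ)`. -/
theorem exists_eLpNorm_le {q : ℝ} (hq : 0 < q) (h : SobolevBound n q) :
    ∃ K : ℝ≥0, ∀ w : H1 n, eLpNorm (toL2 n w) (ENNReal.ofReal q) volume ≤ K * ‖w‖ₑ := by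
  obtain ⟨C, c, hc, hC⟩ := exists_lintegral_rpow_le h
  lift c to ℝ≥0 using hc.le
  have hunit : ∀ w : H1 n, ‖w‖ ≤ c →
      eLpNorm (toL2 n w) (ENNReal.ofReal q) volume ≤ (C ^ (1 / q) : ℝ≥0) := by
    intro w hw
    rw [eLpNorm_eq_lintegral_rpow_enorm_toReal (by simpa using hq) (by simp),
      ENNReal.toReal_ofReal hq.le, ENNReal.coe_rpow_of_nonneg _ (by positivity)]
    exact ENNReal.rpow_le_rpow (hC w hw) (by positivity)
  refine ⟨C ^ (1 / q) * c⁻¹, fun w => ?_⟩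
  rcases eq_or_ne w 0 with rfl | hw
  · rw [map_zero, eLpNorm_congr_ae (Lp.coeFn_zero ℝ 2 volume)]
    simp
  have hw0 : 0 < ‖w‖ := norm_pos_iff.2 hw
  -- Rescaling w to norm c and homogeneity turn the bound on a small ball into a linear one.
  have h1 := hunit ((c / ‖w‖) • w) (by
    rw [norm_smul, Real.norm_of_nonneg (by positivity), div_mul_cancel₀ _ hw0.ne'])
  rw [map_smul, eLpNorm_congr_ae (Lp.coeFn_smul _ _), eLpNorm_const_smul] at h1
  have h2 : ‖w‖₊ * c⁻¹ * ‖(c : ℝ) / ‖w‖‖₊ = 1 := by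
    rw [← NNReal.coe_inj]
    change ‖w‖ * (c : ℝ)⁻¹ * ‖(c : ℝ) / ‖w‖‖ = 1
    rw [Real.norm_of_nonneg (by positivity)]
    field_simp
  calc eLpNorm (toL2 n w) (ENNReal.ofReal q) volume
      = ((‖w‖₊ * c⁻¹ * ‖(c : ℝ) / ‖w‖‖₊ : ℝ≥0) : ℝ≥0∞) *
          eLpNorm (toL2 n w) (ENNReal.ofReal q) volume := by rw [h2]; simp
    _ = ((‖w‖₊ * c⁻¹ : ℝ≥0) : ℝ≥0∞) *
          (‖(c : ℝ) / ‖w‖‖ₑ * eLpNorm (toL2 n w) (ENNReal.ofReal q) volume) := by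
        rw [ENNReal.coe_mul, mul_assoc]
        rfl
    _ ≤ ((‖w‖₊ * c⁻¹ : ℝ≥0) : ℝ≥0∞) * (C ^ (1 / q) : ℝ≥0) := by gcongr
    _ = _ := by
        rw [enorm_eq_nnnorm, ← ENNReal.coe_mul, ← ENNReal.coe_mul]
        congr 1
        ring

theorem abs_rpow_sub_abs_rpow_le {p : ℝ} (hp : 1 < p) (a b : ℝ) :
    |(|a| ^ p - |b| ^ p)| ≤ p * ((|a| + |b|) ^ (p - 1) * |a - b|) := by
  have h := (convex_Icc (0 : ℝ) (|a| + |b|)).norm_image_sub_le_of_norm_hasDerivWithin_le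
    (f := fun x : ℝ => x ^ p) (f' := fun x : ℝ => p * x ^ (p - 1)) (x := |b|) (y := |a|)
    (C := p * (|a| + |b|) ^ (p - 1))
    (fun x _ => (Real.hasDerivAt_rpow_const (Or.inr hp.le)).hasDerivWithinAt)
    (fun x hx => by
      have : 0 ≤ x ^ (p - 1) := Real.rpow_nonneg hx.1 _
      rw [Real.norm_of_nonneg (by positivity)]
      gcongr
      · exact hx.1
      · exact hx.2)
    ⟨abs_nonneg _, by linarith [abs_nonneg a]⟩ ⟨abs_nonneg _, by linarith [abs_nonneg b]⟩
  simp only [Real.norm_eq_abs] at h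
  refine h.trans ?_
  rw [← mul_assoc]
  exact mul_le_mul_of_nonneg_left (abs_abs_sub_abs_le a b) (by positivity)

/-- The mean value bound | |a|^p - |b|^p | ≤ p (|a| + |b|)^{p-1} |a - b| combined with Hölder, 1/2 =
(p-1)/(2p) + 1/(2p). -/
theorem eLpNorm_abs_rpow_sub_le {α : Type*} [MeasurableSpace α] {μ : Measure α} {p : ℝ}
    (hp : 1 < p) {f g : α → ℝ} (hf : AEStronglyMeasurable f μ) (hg : AEStronglyMeasurable g μ) :
    eLpNorm (fun x => |f x| ^ p - |g x| ^ p) 2 μ ≤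
      ENNReal.ofReal p * ((eLpNorm f (ENNReal.ofReal (2 * p)) μ +
        eLpNorm g (ENNReal.ofReal (2 * p)) μ) ^ (p - 1) *
        eLpNorm (f - g) (ENNReal.ofReal (2 * p)) μ) := by
  have hp1 : 0 < p - 1 := by linarith
  have hp0 : 0 < p := by linarith
  have : ENNReal.HolderTriple (ENNReal.ofReal (2 * p / (p - 1))) (ENNReal.ofReal (2 * p)) 2 := by
    refine ⟨?_⟩
    rw [← ENNReal.ofReal_inv_of_pos (by positivity), ← ENNReal.ofReal_inv_of_pos (by positivity),
      ← ENNReal.ofReal_add (by positivity) (by positivity), ← ENNReal.ofReal_ofNat 2,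
      ← ENNReal.ofReal_inv_of_pos (by norm_num)]
    congr 1
    field_simp
    ring
  have hs : AEStronglyMeasurable (fun x => |f x| + |g x|) μ := hf.norm.add hg.norm
  have hs' : AEStronglyMeasurable (fun x => ‖|f x| + |g x|‖ ^ (p - 1)) μ :=
    (hs.norm.aemeasurable.pow_const _).aestronglyMeasurable
  refine (eLpNorm_le_mul_eLpNorm_of_ae_le_mul
    (g := (fun x => ‖|f x| + |g x|‖ ^ (p - 1)) • (f - g)) (c := p)
    (Eventually.of_forall fun x => ?_) 2).trans ?_
  · simp only [Pi.smul_apply', Pi.sub_apply, smul_eq_mul, norm_mul, Real.norm_eq_abs]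
    have h0 : 0 ≤ |f x| + |g x| := by positivity
    rw [abs_of_nonneg h0, abs_of_nonneg (Real.rpow_nonneg h0 _)]
    exact abs_rpow_sub_abs_rpow_le hp _ _
  · gcongr
    refine (eLpNorm_smul_le_mul_eLpNorm (p := ENNReal.ofReal (2 * p / (p - 1)))
      (q := ENNReal.ofReal (2 * p)) (hf.sub hg) hs').trans ?_
    rw [eLpNorm_norm_rpow _ hp1, ← ENNReal.ofReal_mul (by positivity), div_mul_cancel₀ _ hp1.ne']
    gcongr
    have h2 := eLpNorm_add_le (p := ENNReal.ofReal (2 * p)) hf.norm hg.norm (by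
      rw [← ENNReal.ofReal_one]
      exact ENNReal.ofReal_le_ofReal (by linarith))
    rw [eLpNorm_norm, eLpNorm_norm] at h2
    exact h2

/-- The map `u ↦ |u|^p` is locally Lipschitz from `H¹` to `L²`. -/
theorem exists_nemytskii {p : ℝ} (hp : 1 < p) (h : SobolevBound n (2 * p)) :
    ∃ N : H1 n → L2 n, (∀ w, ∀ᵐ x, N w x = |toL2 n w x| ^ p) ∧
      ∀ R : ℝ, ∃ L : ℝ≥0, LipschitzOnWith L N (Metric.closedBall 0 R) := by
  have hp0 : 0 < p := by linarith
  obtain ⟨K, hK⟩ := exists_eLpNorm_le (by positivity) h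
  have hmem : ∀ w : H1 n, MemLp (fun x => |toL2 n w x| ^ p) 2 volume := by
    intro w
    have h1 : AEStronglyMeasurable (toL2 n w) volume := (Lp.memLp (toL2 n w)).1
    refine ⟨(h1.norm.aemeasurable.pow_const p).aestronglyMeasurable, ?_⟩
    have h2 := eLpNorm_norm_rpow (p := 2) (μ := volume) (toL2 n w) hp0
    simp only [Real.norm_eq_abs] at h2
    have h3 : (2 : ℝ≥0∞) * ENNReal.ofReal p = ENNReal.ofReal (2 * p) := by
      rw [ENNReal.ofReal_mul (by norm_num)]
      simp
    rw [h2, h3]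
    refine ENNReal.rpow_lt_top_of_nonneg hp0.le (ne_of_lt ?_)
    exact (hK w).trans_lt (ENNReal.mul_lt_top ENNReal.coe_lt_top enorm_lt_top)
  refine ⟨fun w => (hmem w).toLp _, fun w => (hmem w).coeFn_toLp, fun R => ?_⟩
  refine ⟨p.toNNReal * ((2 * K * R.toNNReal) ^ (p - 1) * K), fun w hw z hz => ?_⟩
  have hR : ∀ y : H1 n, y ∈ Metric.closedBall 0 R → ‖y‖ₑ ≤ R.toNNReal := by
    intro y hy
    rw [mem_closedBall_zero_iff] at hy
    rw [enorm_eq_nnnorm, ENNReal.coe_le_coe]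
    exact NNReal.le_toNNReal_of_coe_le hy
  rw [edist_eq_enorm_sub, edist_eq_enorm_sub, ← MemLp.toLp_sub, Lp.enorm_toLp]
  refine (eLpNorm_abs_rpow_sub_le hp (Lp.memLp (toL2 n w)).1 (Lp.memLp (toL2 n z)).1).trans ?_
  have h3 : eLpNorm (toL2 n w - toL2 n z : Space n → ℝ) (ENNReal.ofReal (2 * p)) volume ≤
      K * ‖w - z‖ₑ := by
    rw [← eLpNorm_congr_ae (Lp.coeFn_sub _ _), ← map_sub]
    exact hK (w - z)
  have h4 : eLpNorm (toL2 n w) (ENNReal.ofReal (2 * p)) volume +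
      eLpNorm (toL2 n z) (ENNReal.ofReal (2 * p)) volume ≤ ((2 * K * R.toNNReal : ℝ≥0) : ℝ≥0∞) := by
    push_cast
    rw [mul_assoc, two_mul (_ * _ : ℝ≥0∞)]
    exact add_le_add ((hK w).trans (mul_le_mul' le_rfl (hR w hw)))
      ((hK z).trans (mul_le_mul' le_rfl (hR z hz)))
  rw [ENNReal.coe_mul, ENNReal.coe_mul, ENNReal.coe_rpow_of_nonneg _ (by linarith), mul_assoc,
    mul_assoc]
  refine mul_le_mul' le_rfl (mul_le_mul' (ENNReal.rpow_le_rpow h4 (by linarith)) h3)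

end Nemytskii

/-! ### The moving frame that removes the unbounded generator. -/

section InteractionPicture

open ContinuousLinearMap

variable {E : Type*} [NormedAddCommGroup E] [NormedSpace ℝ E]

/-- `S` is a strongly continuous group of isometries generated by `K⁻¹`. -/
structure IsGroupOf (K : E →L[ℝ] E) (S : ℝ → E →L[ℝ] E) : Prop where
  norm_map : ∀ t x, ‖S t x‖ = ‖x‖
  map_add : ∀ s t x, S (s + t) x = S s (S t x)
  map_zero : ∀ x, S 0 x = x
  comm : ∀ t x, S t (K x) = K (S t x)
  continuous : ∀ x, Continuous fun t => S t x
  hasDerivAt : ∀ x t, HasDerivAt (fun s => S s (K x)) (S t x) t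

variable {K : E →L[ℝ] E} {S : ℝ → E →L[ℝ] E}

theorem IsGroupOf.map_map_neg (hS : IsGroupOf K S) (t : ℝ) (x : E) : S t (S (-t) x) = x := by
  rw [← hS.map_add, add_neg_cancel, hS.map_zero]

theorem IsGroupOf.continuous_uncurry (hS : IsGroupOf K S) :
    Continuous fun z : ℝ × E => S z.1 z.2 := by
  rw [continuous_iff_continuousAt]
  rintro ⟨t, x⟩
  have h1 : Tendsto (fun z : ℝ × E => S z.1 (z.2 - x)) (𝓝 (t, x)) (𝓝 0) := by
    rw [tendsto_zero_iff_norm_tendsto_zero]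
    simp only [hS.norm_map]
    have : Continuous fun z : ℝ × E => ‖z.2 - x‖ := by fun_prop
    simpa using this.tendsto (t, x)
  have h2 : Tendsto (fun z : ℝ × E => S z.1 x) (𝓝 (t, x)) (𝓝 (S t x)) :=
    ((hS.continuous x).comp continuous_fst).tendsto (t, x)
  have h3 := h1.add h2
  simp only [map_sub, sub_add_cancel, zero_add] at h3
  exact h3

/-- Product rule for the group acting on a curve through the domain of the generator. -/
theorem IsGroupOf.hasDerivWithinAt_apply (hS : IsGroupOf K S) (c : ℝ) {W : ℝ → E} {w z : E}
    {I : Set ℝ} {t : ℝ} (hW : HasDerivWithinAt W w I t) (hWt : W t = K z) :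
    HasDerivWithinAt (fun s => S (c * s) (W s)) (c • S (c * t) z + S (c * t) w) I t := by
  -- W(s) splits into its Taylor remainder, the linear term and W(t). The group is isometric on the
  -- remainder, only strongly continuous on the linear term, and differentiable on W(t) = K z.
  have h1 : HasDerivWithinAt (fun s => S (c * s) (W s - W t - (s - t) • w)) 0 I t := by
    rw [hasDerivWithinAt_iff_isLittleO]
    simp only [sub_self, zero_smul, _root_.map_zero, sub_zero, smul_zero]
    refine Asymptotics.IsLittleO.of_norm_left ?_
    simp only [hS.norm_map]
    exact (hasDerivWithinAt_iff_isLittleO.1 hW).norm_left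
  have h2 : HasDerivWithinAt (fun s => (s - t) • S (c * s) w) (S (c * t) w) I t := by
    rw [hasDerivWithinAt_iff_isLittleO]
    simp only [sub_self, zero_smul, sub_zero, ← smul_sub]
    have h3 : (fun s => S (c * s) w - S (c * t) w) =o[𝓝[I] t] fun _ => (1 : ℝ) := by
      rw [Asymptotics.isLittleO_one_iff]
      have : Continuous fun s => S (c * s) w - S (c * t) w :=
        ((hS.continuous w).comp (continuous_const.mul continuous_id)).sub continuous_const
      have h4 := (this.tendsto t).mono_left (nhdsWithin_le_nhds (s := I))
      simpa using h4
    simpa using (Asymptotics.isBigO_refl (fun s : ℝ => s - t) (𝓝[I] t)).smul_isLittleO h3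
  have h3 : HasDerivWithinAt (fun s => S (c * s) (K z)) (c • S (c * t) z) I t := by
    have h4 : HasDerivAt (fun s : ℝ => c * s) c t := by
      simpa using (hasDerivAt_id t).const_mul c
    exact ((hS.hasDerivAt z (c * t)).scomp t h4).hasDerivWithinAt
  have h4 := (h1.add h2).add h3
  rw [zero_add, add_comm (S (c * t) w)] at h4
  refine h4.congr_of_eventuallyEq (Eventually.of_forall fun s => ?_) ?_
  · simp only [Pi.add_apply, map_sub, map_smul, hWt]
    abel
  · simp [hWt]

/-- This removes K from a differentiated identity: if Z is an antiderivative of G with Z(0) = Y(0),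
then K(Y - Z) has zero derivative, so Y = Z by injectivity. -/
theorem hasDerivWithinAt_of_injective [CompleteSpace E] (hK : Function.Injective K) {T : EReal}
    {Y G : ℝ → E} (hG : ContinuousOn G (timeInterval T))
    (h : ∀ t ∈ timeInterval T, HasDerivWithinAt (fun s => K (Y s)) (K (G t)) (timeInterval T) t) :
    ∀ t ∈ timeInterval T, HasDerivWithinAt Y (G t) (timeInterval T) t := by
  intro t ht
  obtain ⟨r, htr, hr⟩ := exists_real_between ht
  have hr0 : 0 ≤ r := hr.1
  have hsub := Icc_subset_timeInterval hr
  set H : ℝ → E := IccExtend hr0 ((Icc 0 r).domRestrict G) with hH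
  have hHc : Continuous H := (hG.mono hsub).domRestrict.Icc_extend'
  have hHeq : ∀ s ∈ Icc 0 r, H s = G s := fun s hs => by
    rw [hH, IccExtend_of_mem _ _ hs]; rfl
  set Z : ℝ → E := fun s => Y 0 + ∫ τ in (0 : ℝ)..s, H τ with hZ
  have hZd : ∀ s, HasDerivAt Z (H s) s := fun s =>
    (intervalIntegral.integral_hasDerivAt_right (hHc.intervalIntegrable 0 s)
      (hHc.stronglyMeasurableAtFilter _ _) hHc.continuousAt).const_add _
  have hYZ : ∀ s ∈ Icc 0 r, Y s = Z s := by
    intro s hs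
    have hd : ∀ τ ∈ Icc 0 r, HasDerivWithinAt (fun τ => K (Y τ) - K (Z τ)) 0 (Icc 0 r) τ := by
      intro τ hτ
      have h1 := (h τ (hsub hτ)).mono hsub
      have h2 := (K.hasFDerivAt.comp_hasDerivAt τ (hZd τ)).hasDerivWithinAt (s := Icc 0 r)
      rw [hHeq τ hτ] at h2
      have h3 := h1.sub h2
      rwa [sub_self] at h3
    have h3 := (convex_Icc 0 r).norm_image_sub_le_of_norm_hasDerivWithin_le hd (C := 0)
      (by simp) (left_mem_Icc.2 hr0) hs
    have h4 : Z 0 = Y 0 := by simp [hZ]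
    rw [zero_mul, norm_le_zero_iff, h4, sub_self, sub_zero, sub_eq_zero] at h3
    exact hK h3
  have hmem : Icc 0 r ∈ 𝓝[timeInterval T] t := by
    filter_upwards [self_mem_nhdsWithin, mem_nhdsWithin_of_mem_nhds (Iio_mem_nhds htr)] with s hs hs'
    exact ⟨hs.1, le_of_lt hs'⟩
  have h5 := (hZd t).hasDerivWithinAt (s := timeInterval T)
  rw [hHeq t ⟨ht.1, htr.le⟩] at h5
  refine h5.congr_of_eventuallyEq ?_ (hYZ t ⟨ht.1, htr.le⟩)
  filter_upwards [hmem] with s hs using hYZ s hs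

/-- `U` solves `(K U)' = U + K N(t, U)`, that is `U' = K⁻¹ U + N(t, U)` in a weak sense,
on `[0, T)`. -/
structure IsWeakSolution (K : E →L[ℝ] E) (N : ℝ → E → E) (y₀ : E) (T : EReal) (U : ℝ → E) :
    Prop where
  initial : U 0 = y₀
  continuousOn : ContinuousOn U (timeInterval T)
  deriv : ∀ t ∈ timeInterval T,
    HasDerivWithinAt (fun s => K (U s)) (U t + K (N t (U t))) (timeInterval T) t

/-- The vector field of `U' = K⁻¹ U + N(t, U)` in the moving frame of the group `S`. -/
def interactionField (S : ℝ → E →L[ℝ] E) (N : ℝ → E → E) (t : ℝ) (y : E) : E :=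
  S (-t) (N t (S t y))

variable {N : ℝ → E → E} {y₀ : E} {T : EReal}

theorem continuous_interactionField (hS : IsGroupOf K S)
    (hN : Continuous fun z : ℝ × E => N z.1 z.2) :
    Continuous fun z : ℝ × E => interactionField S N z.1 z.2 :=
  hS.continuous_uncurry.comp (continuous_fst.neg.prodMk
    (hN.comp (continuous_fst.prodMk hS.continuous_uncurry)))

theorem isLocallyLipschitzField_interactionField (hS : IsGroupOf K S)
    (hN : IsLocallyLipschitzField N) : IsLocallyLipschitzField (interactionField S N) := by
  intro T R
  obtain ⟨L, hL⟩ := hN T R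
  refine ⟨L, fun t ht => LipschitzOnWith.of_dist_le_mul fun x hx y hy => ?_⟩
  have hb : ∀ x ∈ Metric.closedBall (0 : E) R, S t x ∈ Metric.closedBall (0 : E) R := fun x hx => by
    simpa [hS.norm_map] using hx
  have h := (hL t ht).dist_le_mul _ (hb x hx) _ (hb y hy)
  simp only [dist_eq_norm] at h ⊢
  rwa [interactionField, interactionField, ← map_sub, hS.norm_map, ← hS.norm_map t (x - y), map_sub]

/-- Differentiating S(-t) K U gives -S(-t)U + S(-t)(U + K N). The terms in U cancel, what remains is
K applied to the moving-frame field, and injectivity of K finishes. -/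
theorem IsWeakSolution.isODESolution [CompleteSpace E] (hS : IsGroupOf K S)
    (hK : Function.Injective K) (hN : Continuous fun z : ℝ × E => N z.1 z.2) {U : ℝ → E}
    (hU : IsWeakSolution K N y₀ T U) :
    IsODESolution (interactionField S N) y₀ T (fun t => S (-t) (U t)) := by
  have hYc : ContinuousOn (fun t => S (-t) (U t)) (timeInterval T) :=
    hS.continuous_uncurry.comp_continuousOn (continuous_neg.continuousOn.prodMk hU.continuousOn)
  refine ⟨by simp [hS.map_zero, hU.initial], hasDerivWithinAt_of_injective hK
    ((continuous_interactionField hS hN).comp_continuousOn (continuousOn_id.prodMk hYc))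
    fun t ht => ?_⟩
  have h := hS.hasDerivWithinAt_apply (-1) (hU.deriv t ht) rfl
  have h1 : (fun s => S (-1 * s) (K (U s))) = fun s => K (S (-s) (U s)) := by
    funext s
    rw [hS.comm, neg_one_mul]
  rw [h1] at h
  convert h using 1
  simp only [interactionField, hS.map_map_neg, neg_one_mul, _root_.map_add, neg_smul, one_smul,
    hS.comm]
  abel

theorem IsODESolution.isWeakSolution (hS : IsGroupOf K S) {Y : ℝ → E}
    (hY : IsODESolution (interactionField S N) y₀ T Y) :
    IsWeakSolution K N y₀ T (fun t => S t (Y t)) := by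
  refine ⟨by simp [hS.map_zero, hY.initial],
    hS.continuous_uncurry.comp_continuousOn (continuousOn_id.prodMk hY.continuousOn),
    fun t ht => ?_⟩
  have h := hS.hasDerivWithinAt_apply 1
    (K.hasFDerivAt.comp_hasDerivWithinAt t (hY.deriv t ht)) rfl
  have h1 : (fun s => S (1 * s) ((K ∘ Y) s)) = fun s => K (S s (Y s)) := by
    funext s
    rw [one_mul, Function.comp_apply, hS.comm]
  rw [h1] at h
  convert h using 1
  simp only [interactionField, one_mul, one_smul, hS.comm, hS.map_map_neg]

end InteractionPicture

/-! ### Completeness of H¹ and the skew-adjoint inverse of the Klein-Gordon generator. -/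

section EnergySpace

open ContinuousLinearMap
open scoped InnerProductSpace

variable {n : ℕ}

theorem memLp_of_test {F : Type*} [NormedAddCommGroup F] {ψ : Space n → F} (h : Continuous ψ)
    (hc : HasCompactSupport ψ) : MemLp ψ 2 (volume : Measure (Space n)) :=
  h.memLp_of_hasCompactSupport hc

theorem inner_toLp_eq {f : L2 n} {ψ : Space n → ℝ} (hψ : MemLp ψ 2 volume) :
    ⟪f, hψ.toLp ψ⟫_ℝ = ∫ x, f x * ψ x := by
  rw [L2.inner_def]
  refine integral_congr_ae ?_
  filter_upwards [hψ.coeFn_toLp] with x hx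
  simp [hx, mul_comm]

theorem inner_toLp_single_eq {g : L2Vec n} {i : Fin n} {ψ : Space n → ℝ}
    (hψ : MemLp (fun x => EuclideanSpace.single i (ψ x)) 2 volume) :
    ⟪g, hψ.toLp _⟫_ℝ = ∫ x, g x i * ψ x := by
  rw [L2.inner_def]
  refine integral_congr_ae ?_
  filter_upwards [hψ.coeFn_toLp] with x hx
  rw [hx, EuclideanSpace.inner_single_right]
  simp [mul_comm]

/-- Each weak gradient condition equates L² inner products with fixed elements, so it is a closed
condition. -/
theorem isClosed_H1 (n : ℕ) : IsClosed (H1 n : Set (WithLp 2 (L2 n × L2Vec n))) := by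
  have h : (H1 n : Set (WithLp 2 (L2 n × L2Vec n))) =
      {w | IsWeakGrad (n := n) w.fst w.snd} := rfl
  rw [h]
  simp only [IsWeakGrad, ofPred_forall]
  refine isClosed_iInter fun φ => isClosed_iInter fun hφ => isClosed_iInter fun hc =>
    isClosed_iInter fun i => ?_
  have m1 := memLp_of_test (continuous_partial hφ (EuclideanSpace.single i (1 : ℝ)))
    (hasCompactSupport_partial hc _)
  have m2 : MemLp (fun x => (EuclideanSpace.single i (φ x) : Space n)) 2 volume := by
    have e : (fun x => (EuclideanSpace.single i (φ x) : Space n)) =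
        fun x => φ x • EuclideanSpace.single i (1 : ℝ) := by
      funext x
      ext j
      simp
    rw [e]
    exact memLp_of_test (hφ.continuous.smul continuous_const) hc.smul_right
  simp only [← inner_toLp_eq m1, ← inner_toLp_single_eq m2]
  have c1 : Continuous fun w : WithLp 2 (L2 n × L2Vec n) => w.fst :=
    (WithLp.fstL 2 ℝ (L2 n) (L2Vec n)).continuous
  have c2 : Continuous fun w : WithLp 2 (L2 n × L2Vec n) => w.snd :=
    (WithLp.sndL 2 ℝ (L2 n) (L2Vec n)).continuous
  exact isClosed_eq (c1.inner continuous_const) (c2.inner continuous_const).neg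

instance completeSpace_H1 (n : ℕ) : CompleteSpace (H1 n) := (isClosed_H1 n).completeSpace_coe

theorem toL2_injective (n : ℕ) : Function.Injective (toL2 n) := by
  rw [injective_iff_map_eq_zero]
  intro w hw
  have hf : (w : WithLp 2 (L2 n × L2Vec n)).fst = 0 := hw
  have hg : (w : WithLp 2 (L2 n × L2Vec n)).snd = 0 := by
    have hwk := w.2
    have h0 : ∀ i : Fin n, ∀ᵐ x, (w : WithLp 2 (L2 n × L2Vec n)).snd x i = 0 := by
      intro i
      refine ae_eq_zero_of_integral_contDiff_smul_eq_zero
        ((memLp_coord _ i).locallyIntegrable (by norm_num)) fun φ hφ hc => ?_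
      have h1 := hwk φ hφ hc i
      have h2 : ∫ x, (w : WithLp 2 (L2 n × L2Vec n)).fst x *
          fderiv ℝ φ x (EuclideanSpace.single i 1) = 0 := by
        rw [hf, integral_congr_ae (g := fun _ => (0 : ℝ)) ?_, integral_zero]
        filter_upwards [Lp.coeFn_zero ℝ 2 (volume : Measure (Space n))] with x hx
        rw [hx, Pi.zero_apply, zero_mul]
      rw [h2, zero_eq_neg] at h1
      simpa only [smul_eq_mul, mul_comm] using h1
    refine Lp.ext ?_
    filter_upwards [ae_all_iff.2 h0, Lp.coeFn_zero (Space n) 2 (volume : Measure (Space n))]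
      with x hx hx0
    rw [hx0]
    ext i
    exact hx i
  ext1
  exact WithLp.ofLp_injective 2 (Prod.ext hf hg)

/-- Test functions belong to `H¹`. -/
theorem exists_H1_of_test {φ : Space n → ℝ} (hφ : ContDiff ℝ ∞ φ) (hc : HasCompactSupport φ) :
    ∃ w : H1 n, ∀ᵐ x, toL2 n w x = φ x := by
  have m1 := memLp_of_test hφ.continuous hc
  let G : Space n → Space n := fun x =>
    WithLp.toLp 2 fun i => fderiv ℝ φ x (EuclideanSpace.single i 1)
  have hG : Continuous G := (PiLp.continuous_toLp 2 _).comp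
    (continuous_pi fun i => continuous_partial hφ _)
  have hGc : HasCompactSupport G := by
    refine (hc.fderiv (𝕜 := ℝ)).mono fun x hx hx' => hx ?_
    ext i
    simp [G, hx']
  have m2 := memLp_of_test hG hGc
  refine ⟨⟨WithLp.toLp 2 (m1.toLp φ, m2.toLp G), fun ψ hψ hψc i => ?_⟩, m1.coeFn_toLp⟩
  have e1 : ∫ x, (m1.toLp φ : Space n → ℝ) x * fderiv ℝ ψ x (EuclideanSpace.single i 1) =
      ∫ x, φ x * fderiv ℝ ψ x (EuclideanSpace.single i 1) := by
    refine integral_congr_ae ?_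
    filter_upwards [m1.coeFn_toLp] with x hx
    rw [hx]
  have e2 : ∫ x, (m2.toLp G : Space n → Space n) x i * ψ x =
      ∫ x, fderiv ℝ φ x (EuclideanSpace.single i 1) * ψ x := by
    refine integral_congr_ae ?_
    filter_upwards [m2.coeFn_toLp] with x hx
    rw [hx]
  refine e1.trans (Eq.trans ?_ (congrArg Neg.neg e2.symm))
  have d1 := continuous_partial hφ (EuclideanSpace.single i (1 : ℝ))
  have d2 := continuous_partial hψ (EuclideanSpace.single i (1 : ℝ))
  refine integral_mul_fderiv_eq_neg_fderiv_mul_of_integrable ?_ ?_ ?_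
    (fun x _ => hφ.differentiable (by simp) x) (fun x _ => hψ.differentiable (by simp) x)
  · exact (d1.mul hψ.continuous).integrable_of_hasCompactSupport hψc.mul_left
  · exact (hφ.continuous.mul d2).integrable_of_hasCompactSupport hc.mul_right
  · exact (hφ.continuous.mul hψ.continuous).integrable_of_hasCompactSupport hc.mul_right

/-- The kernel of J* is orthogonal to the range of J, which contains all test functions. -/
theorem adjoint_toL2_injective (n : ℕ) : Function.Injective (adjoint (toL2 n)) := by
  rw [injective_iff_map_eq_zero]
  intro v hv
  have h : ∀ᵐ x, v x = 0 := by
    refine ae_eq_zero_of_integral_contDiff_smul_eq_zero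
      ((Lp.memLp v).locallyIntegrable (by norm_num)) fun φ hφ hc => ?_
    obtain ⟨w, hw⟩ := exists_H1_of_test hφ hc
    have h1 : ⟪v, toL2 n w⟫_ℝ = 0 := by rw [← adjoint_inner_left, hv, inner_zero_left]
    rw [← h1, L2.inner_def]
    refine integral_congr_ae ?_
    filter_upwards [hw] with x hx
    simp [hx]
  refine Lp.ext ?_
  filter_upwards [h, Lp.coeFn_zero ℝ 2 (volume : Measure (Space n))] with x hx hx0
  rw [hx, hx0]
  rfl

section WaveInverse

variable {V H : Type*} [NormedAddCommGroup V] [InnerProductSpace ℝ V] [CompleteSpace V]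
  [NormedAddCommGroup H] [InnerProductSpace ℝ H] [CompleteSpace H]

/-- The inverse `(u, v) ↦ (-J* v, J u)` of the generator of the wave group on `V × H` associated
with an embedding `J : V → H`. -/
def waveInverse (J : V →L[ℝ] H) : WithLp 2 (V × H) →L[ℝ] WithLp 2 (V × H) :=
  (WithLp.prodContinuousLinearEquiv 2 ℝ V H).symm.toContinuousLinearMap ∘L
    ((-(adjoint J) ∘L WithLp.sndL 2 ℝ V H).prod (J ∘L WithLp.fstL 2 ℝ V H))

theorem waveInverse_fst (J : V →L[ℝ] H) (U : WithLp 2 (V × H)) :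
    (waveInverse J U).fst = -adjoint J U.snd := rfl

theorem waveInverse_snd (J : V →L[ℝ] H) (U : WithLp 2 (V × H)) :
    (waveInverse J U).snd = J U.fst := rfl

theorem star_waveInverse (J : V →L[ℝ] H) : star (waveInverse J) = -waveInverse J := by
  rw [star_eq_adjoint]
  refine ((eq_adjoint_iff _ _).2 fun x y => ?_).symm
  have e : ∀ a b : WithLp 2 (V × H), ⟪a, b⟫_ℝ = ⟪a.fst, b.fst⟫_ℝ + ⟪a.snd, b.snd⟫_ℝ :=
    fun a b => rfl
  rw [neg_apply, inner_neg_left, e, e, waveInverse_fst, waveInverse_snd,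
    waveInverse_fst, waveInverse_snd, inner_neg_left, inner_neg_right,
    adjoint_inner_left, adjoint_inner_right]
  ring

theorem waveInverse_injective {J : V →L[ℝ] H} (hJ : Function.Injective J)
    (hJ' : Function.Injective (adjoint J)) : Function.Injective (waveInverse J) := by
  rw [injective_iff_map_eq_zero]
  intro U hU
  have h1 : -adjoint J U.snd = 0 := congrArg WithLp.fst hU
  have h2 : J U.fst = 0 := congrArg WithLp.snd hU
  have h3 : U.snd = 0 := hJ' (by rw [neg_eq_zero.1 h1, map_zero])
  have h4 : U.fst = 0 := hJ (by rw [h2, map_zero])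
  exact WithLp.ofLp_injective 2 (Prod.ext h4 h3)

/-- Through the Riesz isometry, differentiability in H⁻¹ is differentiability of the representative
in H¹. -/
theorem hasDerivWithinAt_toDual_iff {f : ℝ → V} {a : V} {I : Set ℝ} {t : ℝ} :
    HasDerivWithinAt (fun s => InnerProductSpace.toDual ℝ V (f s)) (InnerProductSpace.toDual ℝ V a)
      I t ↔ HasDerivWithinAt f a I t := by
  rw [hasDerivWithinAt_iff_isLittleO, hasDerivWithinAt_iff_isLittleO,
    ← Asymptotics.isLittleO_norm_left,
    ← Asymptotics.isLittleO_norm_left (f' := fun s => f s - f t - (s - t) • a)]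
  refine Eq.to_iff (congrArg (fun g : ℝ → ℝ => g =o[𝓝[I] t] fun s => s - t) (funext fun s => ?_))
  rw [← (InnerProductSpace.toDual ℝ V).norm_map (f s - f t - (s - t) • a)]
  simp

/-- The first order system `(K U)' = U + K (0, g)` in terms of the two components of `U`. -/
theorem hasDerivWithinAt_waveInverse_iff {J : V →L[ℝ] H} {u : ℝ → V} {v : ℝ → H} {g : H}
    {I : Set ℝ} {t : ℝ} :
    HasDerivWithinAt (fun s => waveInverse J (WithLp.toLp 2 (u s, v s)))
        (WithLp.toLp 2 (u t, v t) + waveInverse J (WithLp.toLp 2 (0, g))) I t ↔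
      HasDerivWithinAt (fun s => J (u s)) (v t) I t ∧
      HasDerivWithinAt (fun s => InnerProductSpace.toDual ℝ V (adjoint J (v s)))
        (InnerProductSpace.toDual ℝ V (adjoint J g - u t)) I t := by
  have e : WithLp.toLp 2 (u t, v t) + waveInverse J (WithLp.toLp 2 (0, g)) =
      WithLp.toLp 2 (-(adjoint J g - u t), v t) := by
    refine WithLp.ofLp_injective 2 (Prod.ext ?_ ?_)
    · change u t + -adjoint J g = -(adjoint J g - u t)
      abel
    · change v t + J 0 = v t
      rw [map_zero, add_zero]
  rw [hasDerivWithinAt_toDual_iff, e]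
  constructor
  · intro h
    refine ⟨(WithLp.sndL 2 ℝ V H).hasFDerivAt.comp_hasDerivWithinAt t h, ?_⟩
    have h1 := ((WithLp.fstL 2 ℝ V H).hasFDerivAt.comp_hasDerivWithinAt t h).neg
    have h2 : -(WithLp.fstL 2 ℝ V H) (WithLp.toLp 2 (-(adjoint J g - u t), v t)) =
        adjoint J g - u t := neg_neg _
    rw [h2] at h1
    exact h1.congr (fun s _ => (neg_neg (adjoint J (v s))).symm) (neg_neg (adjoint J (v t))).symm
  · rintro ⟨h1, h2⟩
    exact (WithLp.prodContinuousLinearEquiv 2 ℝ V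
      H).symm.toContinuousLinearMap.hasFDerivAt.comp_hasDerivWithinAt t (h2.neg.prodMk h1)

end WaveInverse

/-- The energy space `H¹ × L²`. -/
abbrev Energy (n : ℕ) : Type := WithLp 2 (H1 n × L2 n)

/-- The inverse `(u, v) ↦ (-(1 - Δ)⁻¹ v, u)` of the generator `(u, v) ↦ (v, -(1 - Δ) u)` of the
Klein-Gordon group. -/
abbrev kleinGordonInverse (n : ℕ) : Energy n →L[ℝ] Energy n := waveInverse (toL2 n)

theorem kleinGordonInverse_injective (n : ℕ) : Function.Injective (kleinGordonInverse n) :=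
  waveInverse_injective (toL2_injective n) (adjoint_toL2_injective n)

theorem exists_kleinGordonGroup (n : ℕ) :
    ∃ S : ℝ → Energy n →L[ℝ] Energy n, IsGroupOf (kleinGordonInverse n) S := by
  obtain ⟨S, h1, h2, h3, h4, h5, h6⟩ :=
    exists_skewGroup (star_waveInverse (toL2 n)) (kleinGordonInverse_injective n)
  exact ⟨S, h1, h2, h3, h4, h5, h6⟩

end EnergySpace

/-! ### Right-hand sides in L² as elements of H⁻¹. -/

section NegativeSobolev

open ContinuousLinearMap
open scoped InnerProductSpace

variable {n : ℕ}

theorem toHNeg_apply (f : L2 n) (ψ : H1 n) : toHNeg f ψ = ⟪f, toL2 n ψ⟫_ℝ := rfl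

theorem laplacian_apply (u ψ : H1 n) : laplacian u ψ = -⟪grad n u, grad n ψ⟫_ℝ := rfl

theorem isGivenBy_iff {F : HNeg n} {g : Space n → ℝ} {f : L2 n} (h : ∀ᵐ x, f x = g x) :
    IsGivenBy F g ↔ F = toHNeg f := by
  have h1 : ∀ ψ : H1 n, (fun x => ⟪f x, toL2 n ψ x⟫_ℝ) =ᵐ[volume] fun x => g x * toL2 n ψ x := by
    intro ψ
    filter_upwards [h] with x hx
    simp [hx, mul_comm]
  have h2 : ∀ ψ : H1 n, toHNeg f ψ = ∫ x, g x * toL2 n ψ x := fun ψ => by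
    rw [toHNeg_apply, L2.inner_def, integral_congr_ae (h1 ψ)]
  constructor
  · intro hF
    ext ψ
    rw [(hF ψ).2, h2]
  · rintro rfl ψ
    exact ⟨(L2.integrable_inner f (toL2 n ψ)).congr (h1 ψ), h2 ψ⟩

end NegativeSobolev

/-! ### Continuous differentiability on [0, T) from explicit derivatives. -/

section Derivatives

variable {E : Type*} [NormedAddCommGroup E] [NormedSpace ℝ E] {T : EReal} {f f' f'' : ℝ → E}

theorem contDiffOn_one_of_hasDerivWithinAt
    (h : ∀ t ∈ timeInterval T, HasDerivWithinAt f (f' t) (timeInterval T) t)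
    (hc : ContinuousOn f' (timeInterval T)) : ContDiffOn ℝ 1 f (timeInterval T) := by
  have hu := uniqueDiffOn_timeInterval T
  rw [show (1 : WithTop ℕ∞) = 0 + 1 from rfl, contDiffOn_succ_iff_derivWithin hu]
  refine ⟨fun t ht => (h t ht).differentiableWithinAt, by simp, ?_⟩
  exact contDiffOn_zero.2 (hc.congr fun t ht => (h t ht).derivWithin (hu t ht))

theorem contDiffOn_two_of_hasDerivWithinAt
    (h : ∀ t ∈ timeInterval T, HasDerivWithinAt f (f' t) (timeInterval T) t)
    (h' : ∀ t ∈ timeInterval T, HasDerivWithinAt f' (f'' t) (timeInterval T) t)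
    (hc : ContinuousOn f'' (timeInterval T)) : ContDiffOn ℝ 2 f (timeInterval T) := by
  have hu := uniqueDiffOn_timeInterval T
  rw [show (2 : WithTop ℕ∞) = 1 + 1 from by norm_num, contDiffOn_succ_iff_derivWithin hu]
  refine ⟨fun t ht => (h t ht).differentiableWithinAt, by simp, ?_⟩
  exact (contDiffOn_one_of_hasDerivWithinAt h' hc).congr fun t ht => (h t ht).derivWithin (hu t ht)

end Derivatives

/-! ### Equivalence of the second order equation in V* with the first order system. -/

section SecondOrder

open ContinuousLinearMap
open scoped InnerProductSpace

variable {V H : Type*} [NormedAddCommGroup V] [InnerProductSpace ℝ V]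
  [NormedAddCommGroup H] [InnerProductSpace ℝ H]

/-- The embedding `H → V*` dual to an embedding `J : V → H`. -/
def dualEmbedding (J : V →L[ℝ] H) : H →L[ℝ] StrongDual ℝ V :=
  LinearMap.mkContinuous
    { toFun := fun f => (innerSL ℝ f).comp J
      map_add' := fun f g => by ext ψ; simp
      map_smul' := fun c f => by ext ψ; simp } ‖J‖ fun f => by
    refine (opNorm_comp_le _ _).trans ?_
    rw [innerSL_apply_norm, mul_comm]

variable {J : V →L[ℝ] H} {u : ℝ → V} {v g : ℝ → H} {T : EReal}

theorem hasDerivWithinAt_dual {w : H} {t : ℝ} {I : Set ℝ}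
    (h : HasDerivWithinAt (fun s => J (u s)) w I t) :
    HasDerivWithinAt (fun s => (innerSL ℝ (J (u s))).comp J) ((innerSL ℝ w).comp J) I t :=
  (dualEmbedding J).hasFDerivAt.comp_hasDerivWithinAt t h

theorem iteratedDerivWithin_one_dual
    (h : ∀ t ∈ timeInterval T, HasDerivWithinAt (fun s => J (u s)) (v t) (timeInterval T) t)
    {t : ℝ} (ht : t ∈ timeInterval T) :
    iteratedDerivWithin 1 (fun s => (innerSL ℝ (J (u s))).comp J) (timeInterval T) t =
      (innerSL ℝ (v t)).comp J := by
  rw [iteratedDerivWithin_one]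
  exact (hasDerivWithinAt_dual (h t ht)).derivWithin (uniqueDiffOn_timeInterval T t ht)

theorem iteratedDerivWithin_two_dual
    (h : ∀ t ∈ timeInterval T, HasDerivWithinAt (fun s => J (u s)) (v t) (timeInterval T) t)
    {t : ℝ} (ht : t ∈ timeInterval T) :
    iteratedDerivWithin 2 (fun s => (innerSL ℝ (J (u s))).comp J) (timeInterval T) t =
      derivWithin (fun s => (innerSL ℝ (v s)).comp J) (timeInterval T) t := by
  rw [iteratedDerivWithin_succ]
  exact derivWithin_congr (fun s hs => iteratedDerivWithin_one_dual h hs)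
    (iteratedDerivWithin_one_dual h ht)

variable [CompleteSpace V] [CompleteSpace H]

/-- This identifies J* followed by Riesz with the embedding of H into V*; hence the first component
of the system lives in H⁻¹. -/
theorem toDual_adjoint (J : V →L[ℝ] H) (f : H) :
    InnerProductSpace.toDual ℝ V (adjoint J f) = (innerSL ℝ f).comp J := by
  ext ψ
  rw [InnerProductSpace.toDual_apply_apply, adjoint_inner_left]
  rfl

/-- A solution of the second order equation `u'' = g - J* u` in `V*` solves the first order
system. -/
theorem hasDerivWithinAt_waveInverse_of_contDiffOn
    (h1 : DifferentiableOn ℝ (fun s => J (u s)) (timeInterval T))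
    (h2 : ContDiffOn ℝ 2 (fun s => (innerSL ℝ (J (u s))).comp J) (timeInterval T))
    (heq : ∀ t ∈ timeInterval T,
      iteratedDerivWithin 2 (fun s => (innerSL ℝ (J (u s))).comp J) (timeInterval T) t =
        InnerProductSpace.toDual ℝ V (adjoint J (g t) - u t)) {t : ℝ} (ht : t ∈ timeInterval T) :
    HasDerivWithinAt (fun s => waveInverse J
        (WithLp.toLp 2 (u s, derivWithin (fun s => J (u s)) (timeInterval T) s)))
      (WithLp.toLp 2 (u t, derivWithin (fun s => J (u s)) (timeInterval T) t) +
        waveInverse J (WithLp.toLp 2 (0, g t))) (timeInterval T) t := by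
  have hd : ∀ t ∈ timeInterval T, HasDerivWithinAt (fun s => J (u s))
      (derivWithin (fun s => J (u s)) (timeInterval T) t) (timeInterval T) t :=
    fun t ht => (h1 t ht).hasDerivWithinAt
  refine hasDerivWithinAt_waveInverse_iff.2 ⟨hd t ht, ?_⟩
  simp only [toDual_adjoint]
  rw [← heq t ht, iteratedDerivWithin_two_dual hd ht]
  refine DifferentiableWithinAt.hasDerivWithinAt ?_
  have h3 : DifferentiableOn ℝ
      (iteratedDerivWithin 1 (fun s => (innerSL ℝ (J (u s))).comp J) (timeInterval T))
      (timeInterval T) :=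
    h2.differentiableOn_iteratedDerivWithin (by norm_num) (uniqueDiffOn_timeInterval T)
  exact (h3 t ht).congr (fun s hs => (iteratedDerivWithin_one_dual hd hs).symm)
    (iteratedDerivWithin_one_dual hd ht).symm

/-- A solution of the first order system solves the second order equation `u'' = g - J* u`. -/
theorem contDiffOn_of_hasDerivWithinAt_waveInverse {U G : ℝ → WithLp 2 (V × H)}
    (hG : ∀ t, (G t).fst = 0)
    (h : ∀ t ∈ timeInterval T, HasDerivWithinAt (fun s => waveInverse J (U s))
      (U t + waveInverse J (G t)) (timeInterval T) t)
    (hU : ContinuousOn U (timeInterval T)) (hGc : ContinuousOn G (timeInterval T)) :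
    ContDiffOn ℝ 1 (fun s => J (U s).fst) (timeInterval T) ∧
      ContDiffOn ℝ 2 (fun s => (innerSL ℝ (J (U s).fst)).comp J) (timeInterval T) ∧
      (∀ t ∈ timeInterval T,
        derivWithin (fun s => J (U s).fst) (timeInterval T) t = (U t).snd) ∧
      ∀ t ∈ timeInterval T,
        iteratedDerivWithin 2 (fun s => (innerSL ℝ (J (U s).fst)).comp J) (timeInterval T) t =
          InnerProductSpace.toDual ℝ V (adjoint J (G t).snd - (U t).fst) := by
  have hG' : ∀ t, G t = WithLp.toLp 2 (0, (G t).snd) := fun t =>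
    WithLp.ofLp_injective 2 (Prod.ext (hG t) rfl)
  have h' : ∀ t ∈ timeInterval T, HasDerivWithinAt
      (fun s => waveInverse J (WithLp.toLp 2 ((U s).fst, (U s).snd)))
      (WithLp.toLp 2 ((U t).fst, (U t).snd) + waveInverse J (WithLp.toLp 2 (0, (G t).snd)))
      (timeInterval T) t := fun t ht => by
    rw [← hG']
    exact h t ht
  have hu := (WithLp.fstL 2 ℝ V H).continuous.comp_continuousOn hU
  have hv := (WithLp.sndL 2 ℝ V H).continuous.comp_continuousOn hU
  have hg := (WithLp.sndL 2 ℝ V H).continuous.comp_continuousOn hGc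
  have hud := uniqueDiffOn_timeInterval T
  have hd := fun t ht => (hasDerivWithinAt_waveInverse_iff.1 (h' t ht)).1
  have hd' := fun t ht => (hasDerivWithinAt_waveInverse_iff.1 (h' t ht)).2
  simp only [toDual_adjoint] at hd'
  refine ⟨contDiffOn_one_of_hasDerivWithinAt hd hv,
    contDiffOn_two_of_hasDerivWithinAt (fun t ht => hasDerivWithinAt_dual (hd t ht)) hd' ?_,
    fun t ht => (hd t ht).derivWithin (hud t ht), fun t ht => ?_⟩
  · exact (InnerProductSpace.toDual ℝ V).continuous.comp_continuousOn
      (((adjoint J).continuous.comp_continuousOn hg).sub hu)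
  · rw [iteratedDerivWithin_two_dual hd ht]
    exact (hd' t ht).derivWithin (hud t ht)

end SecondOrder

/-! ### Strong solutions of the wave equation versus weak solutions of the system. -/

section Translation

open ContinuousLinearMap
open scoped InnerProductSpace NNReal

variable {n : ℕ} {p : ℝ} {b : ℝ → ℝ} {N : H1 n → L2 n} {u₀ : H1 n} {u₁ : L2 n} {T : EReal}

/-- The lower order terms `(0, |u|^p - b v + u)` of the equation written as a first order system
for `(u, v)` driven by the Klein-Gordon generator. -/
def forcing (N : H1 n → L2 n) (b : ℝ → ℝ) (t : ℝ) (U : Energy n) : Energy n :=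
  WithLp.toLp 2 (0, N U.fst - b (max t 0) • U.snd + toL2 n U.fst)

theorem continuous_energy_fst : Continuous fun U : Energy n => U.fst :=
  (WithLp.fstL 2 ℝ (H1 n) (L2 n)).continuous

theorem continuous_energy_snd : Continuous fun U : Energy n => U.snd :=
  (WithLp.sndL 2 ℝ (H1 n) (L2 n)).continuous

/-- Freezing b at b(0) for negative times makes the forcing continuous on all of ℝ and changes
nothing on [0, T). -/
theorem continuous_comp_max (hb : ContinuousOn b (Ici 0)) : Continuous fun t => b (max t 0) :=
  hb.comp_continuous (continuous_id.max continuous_const) fun t => le_max_right t 0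

theorem continuous_of_lipschitzOn_closedBall {E F : Type*} [SeminormedAddCommGroup E]
    [PseudoMetricSpace F] {f : E → F}
    (h : ∀ R : ℝ, ∃ L : ℝ≥0, LipschitzOnWith L f (Metric.closedBall 0 R)) : Continuous f := by
  rw [continuous_iff_continuousAt]
  intro x
  obtain ⟨L, hL⟩ := h (‖x‖ + 1)
  refine hL.continuousOn.continuousAt (mem_of_superset (Metric.closedBall_mem_nhds x one_pos) ?_)
  intro y hy
  rw [mem_closedBall_zero_iff]
  rw [Metric.mem_closedBall, dist_eq_norm] at hy
  have := norm_add_le (y - x) x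
  rw [sub_add_cancel] at this
  linarith

theorem continuous_forcing (hN : Continuous N) (hb : ContinuousOn b (Ici 0)) :
    Continuous fun z : ℝ × Energy n => forcing N b z.1 z.2 := by
  have h1 := continuous_energy_fst (n := n).comp (continuous_snd (X := ℝ))
  have h2 := continuous_energy_snd (n := n).comp (continuous_snd (X := ℝ))
  exact (WithLp.prod_continuous_toLp 2 (H1 n) (L2 n)).comp (continuous_const.prodMk
    (((hN.comp h1).sub (((continuous_comp_max hb).comp continuous_fst).smul h2)).add
      ((toL2 n).continuous.comp h1)))

theorem norm_energy_sq (U : Energy n) : ‖U‖ ^ 2 = ‖U.fst‖ ^ 2 + ‖U.snd‖ ^ 2 :=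
  WithLp.prod_norm_sq_eq_of_L2 U

theorem norm_energy_fst_le (U : Energy n) : ‖U.fst‖ ≤ ‖U‖ := by
  nlinarith [norm_energy_sq U, norm_nonneg U.fst, norm_nonneg U, sq_nonneg ‖U.snd‖]

theorem norm_energy_snd_le (U : Energy n) : ‖U.snd‖ ≤ ‖U‖ := by
  nlinarith [norm_energy_sq U, norm_nonneg U.snd, norm_nonneg U, sq_nonneg ‖U.fst‖]

theorem isLocallyLipschitzField_forcing
    (hN : ∀ R : ℝ, ∃ L : ℝ≥0, LipschitzOnWith L N (Metric.closedBall 0 R))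
    (hb : ContinuousOn b (Ici 0)) : IsLocallyLipschitzField (forcing N b) := by
  intro T R
  obtain ⟨L, hL⟩ := hN R
  obtain ⟨B, hB⟩ := (isCompact_Icc (a := (0 : ℝ)) (b := T)).exists_bound_of_continuousOn
    (continuous_comp_max hb).continuousOn
  -- The three summands come from the nonlinearity, from the damping with b bounded on [0, T], and
  -- from the inclusion H¹ → L² of norm at most 1.
  refine ⟨L + B.toNNReal + 1, fun t ht => LipschitzOnWith.of_dist_le_mul fun x hx y hy => ?_⟩
  have hball : ∀ x ∈ Metric.closedBall (0 : Energy n) R,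
      x.fst ∈ Metric.closedBall (0 : H1 n) R := fun x hx => by
    rw [mem_closedBall_zero_iff] at hx ⊢
    exact (norm_energy_fst_le x).trans hx
  have h1 := hL.dist_le_mul _ (hball x hx) _ (hball y hy)
  rw [dist_eq_norm, dist_eq_norm] at h1
  have hfst : ‖x.fst - y.fst‖ ≤ ‖x - y‖ := norm_energy_fst_le (x - y)
  have hsnd : ‖x.snd - y.snd‖ ≤ ‖x - y‖ := norm_energy_snd_le (x - y)
  have h2 : ‖forcing N b t x - forcing N b t y‖ =
      ‖(N x.fst - N y.fst) - b (max t 0) • (x.snd - y.snd) + toL2 n (x.fst - y.fst)‖ := by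
    have e : forcing N b t x - forcing N b t y = WithLp.toLp 2 ((0 : H1 n),
        (N x.fst - N y.fst) - b (max t 0) • (x.snd - y.snd) + toL2 n (x.fst - y.fst)) := by
      refine WithLp.ofLp_injective 2 (Prod.ext (sub_zero 0) ?_)
      rw [smul_sub, map_sub]
      exact (add_sub_add_comm _ _ _ _).trans
        (congrArg (· + (toL2 n x.fst - toL2 n y.fst)) (sub_sub_sub_comm _ _ _ _))
    rw [e]
    exact WithLp.norm_toLp_snd 2 (H1 n) (L2 n) _
  rw [dist_eq_norm, dist_eq_norm, h2]
  have h3 := norm_add_le ((N x.fst - N y.fst) - b (max t 0) • (x.snd - y.snd))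
    (toL2 n (x.fst - y.fst))
  have h4 := norm_sub_le (N x.fst - N y.fst) (b (max t 0) • (x.snd - y.snd))
  rw [norm_smul] at h4
  have h5 := norm_toL2_le (x.fst - y.fst)
  have h6 : ‖b (max t 0)‖ * ‖x.snd - y.snd‖ ≤ B.toNNReal * ‖x - y‖ :=
    mul_le_mul ((hB t ht).trans (Real.le_coe_toNNReal B)) hsnd (norm_nonneg _) B.toNNReal.coe_nonneg
  have h7 : L * ‖x.fst - y.fst‖ ≤ L * ‖x - y‖ := by gcongr
  push_cast
  linarith

/-- The Riesz map of H¹ is 1 - Δ, so the term u added in the forcing cancels the mass term and the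
damped wave equation reappears. -/
theorem toDual_generator (t : ℝ) (U : Energy n) :
    InnerProductSpace.toDual ℝ (H1 n) (adjoint (toL2 n) (forcing N b t U).snd - U.fst) =
      laplacian U.fst + toHNeg (N U.fst) - b (max t 0) • toHNeg U.snd := by
  ext ψ
  have h1 : ⟪U.fst, ψ⟫_ℝ = ⟪toL2 n U.fst, toL2 n ψ⟫_ℝ + ⟪grad n U.fst, grad n ψ⟫_ℝ := rfl
  have h2 : (forcing N b t U).snd = N U.fst - b (max t 0) • U.snd + toL2 n U.fst := rfl
  rw [InnerProductSpace.toDual_apply_apply, inner_sub_left, adjoint_inner_left, h1, h2,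
    inner_add_left, inner_sub_left, real_inner_smul_left, sub_apply, add_apply, smul_apply,
    toHNeg_apply, toHNeg_apply, laplacian_apply, smul_eq_mul]
  ring

theorem IsStrongSolution.isWeakSolution (hN : ∀ w, ∀ᵐ x, N w x = |toL2 n w x| ^ p)
    {u : ℝ → H1 n} (hu : IsStrongSolution p b u₀ u₁ T u) :
    IsWeakSolution (kleinGordonInverse n) (forcing N b) (WithLp.toLp 2 (u₀, u₁)) T
      (fun t => WithLp.toLp 2 (u t, velocity T u t)) := by
  refine ⟨by rw [hu.initial_position, hu.initial_velocity], ?_, fun t ht => ?_⟩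
  · exact (WithLp.prod_continuous_toLp 2 (H1 n) (L2 n)).comp_continuousOn
      (hu.continuousOn_H1.prodMk (hu.contDiffOn_L2.continuousOn_derivWithin
        (uniqueDiffOn_timeInterval T) (by norm_num)))
  · refine hasDerivWithinAt_waveInverse_of_contDiffOn (J := toL2 n) (u := u)
      (g := fun t => (forcing N b t (WithLp.toLp 2 (u t, velocity T u t))).snd)
      (hu.contDiffOn_L2.differentiableOn (by norm_num)) hu.contDiffOn_HNeg (fun s hs => ?_) ht
    have heq := (isGivenBy_iff (hN (u s))).1 (hu.equation s hs)
    have hgen := toDual_generator (N := N) (b := b) s (WithLp.toLp 2 (u s, velocity T u s))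
    rw [max_eq_left hs.1] at hgen
    refine Eq.trans ?_ hgen.symm
    change acceleration T u s = laplacian (u s) + toHNeg (N (u s)) - b s • toHNeg (velocity T u s)
    rw [← heq]
    abel

theorem IsWeakSolution.secondOrder (hNc : Continuous N) (hb : ContinuousOn b (Ici 0))
    {y₀ : Energy n} {U : ℝ → Energy n}
    (hU : IsWeakSolution (kleinGordonInverse n) (forcing N b) y₀ T U) :
    ContDiffOn ℝ 1 (fun s => toL2 n (U s).fst) (timeInterval T) ∧
      ContDiffOn ℝ 2 (fun s => toHNeg (toL2 n (U s).fst)) (timeInterval T) ∧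
      (∀ t ∈ timeInterval T, velocity T (fun s => (U s).fst) t = (U t).snd) ∧
      ∀ t ∈ timeInterval T, acceleration T (fun s => (U s).fst) t =
        InnerProductSpace.toDual ℝ (H1 n)
          (adjoint (toL2 n) (forcing N b t (U t)).snd - (U t).fst) := by
  have hpair : ContinuousOn (fun t => (t, U t)) (timeInterval T) :=
    continuousOn_id.prodMk hU.continuousOn
  have hG := (continuous_forcing hNc hb).comp_continuousOn hpair
  exact contDiffOn_of_hasDerivWithinAt_waveInverse (J := toL2 n) (U := U)
    (G := fun t => forcing N b t (U t)) (fun _ => rfl) hU.deriv hU.continuousOn hG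

theorem IsWeakSolution.isStrongSolution (hN : ∀ w, ∀ᵐ x, N w x = |toL2 n w x| ^ p)
    (hNc : Continuous N) (hb : ContinuousOn b (Ici 0)) (hT : 0 < T) {U : ℝ → Energy n}
    (hU : IsWeakSolution (kleinGordonInverse n) (forcing N b) (WithLp.toLp 2 (u₀, u₁)) T U) :
    IsStrongSolution p b u₀ u₁ T (fun t => (U t).fst) := by
  obtain ⟨h1, h2, hv, ha⟩ := hU.secondOrder hNc hb
  refine ⟨hT, continuous_energy_fst.comp_continuousOn hU.continuousOn, h1, h2, ?_, ?_,
    fun t ht => ?_⟩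
  · exact congrArg WithLp.fst hU.initial
  · exact (hv 0 (zero_mem_timeInterval hT)).trans (congrArg WithLp.snd hU.initial)
  · rw [isGivenBy_iff (hN (U t).fst), ha t ht, hv t ht, toDual_generator, max_eq_left ht.1]
    abel

theorem energyNorm_eq (hNc : Continuous N) (hb : ContinuousOn b (Ici 0))
    {y₀ : Energy n} {U : ℝ → Energy n}
    (hU : IsWeakSolution (kleinGordonInverse n) (forcing N b) y₀ T U) {t : ℝ}
    (ht : t ∈ timeInterval T) : energyNorm T (fun s => (U s).fst) t = ‖U t‖ := by
  rw [energyNorm, (hU.secondOrder hNc hb).2.2.1 t ht, ← norm_energy_sq,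
    Real.sqrt_sq (norm_nonneg _)]

end Translation

end DampedWave

end

/-! ### Assembly: transfer of the ODE results to strong solutions. -/

theorem propositionA (n : ℕ) (hn : 1 ≤ n) (p : ℝ) (hp : 1 < p)
    (hpn : 3 ≤ n → p ≤ (n : ℝ) / ((n : ℝ) - 2))
    (b : ℝ → ℝ) (hb_smooth : ContDiffOn ℝ ∞ b (Set.Ici 0)) (hb_nonneg : ∀ t, 0 ≤ t → 0 ≤ b t)
    (u₀ : DampedWave.H1 n) (u₁ : DampedWave.L2 n) :
    -- local existence of a unique strong solution
    (∃ T : ℝ, 0 < T ∧ ∃ u : ℝ → DampedWave.H1 n,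
      DampedWave.IsStrongSolution p b u₀ u₁ (T : EReal) u ∧
      ∀ v : ℝ → DampedWave.H1 n, DampedWave.IsStrongSolution p b u₀ u₁ (T : EReal) v →
        Set.EqOn v u (DampedWave.timeInterval (T : EReal))) ∧
    -- uniqueness on every interval of existence
    (∀ (T : EReal) (u v : ℝ → DampedWave.H1 n),
      DampedWave.IsStrongSolution p b u₀ u₁ T u → DampedWave.IsStrongSolution p b u₀ u₁ T v →
        Set.EqOn u v (DampedWave.timeInterval T)) ∧
    -- the solution exists up to the lifespan, and the blow-up alternative holds
    (∃ u : ℝ → DampedWave.H1 n,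
      DampedWave.IsStrongSolution p b u₀ u₁ (DampedWave.lifespan p b u₀ u₁) u ∧
      (DampedWave.lifespan p b u₀ u₁ < ⊤ →
        Filter.Tendsto
          (DampedWave.energyNorm (DampedWave.lifespan p b u₀ u₁) u)
          (𝓝[<] (DampedWave.lifespan p b u₀ u₁).toReal) Filter.atTop)) := by
  open DampedWave in
  have hsob : SobolevBound n (2 * p) := by
    refine sobolevBound hn (by linarith) fun h => ?_
    rw [mul_div_assoc]
    exact mul_le_mul_of_nonneg_left (hpn h) (by norm_num)
  obtain ⟨N, hN, hNL⟩ := exists_nemytskii hp hsob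
  obtain ⟨S, hS⟩ := exists_kleinGordonGroup n
  have hbc : ContinuousOn b (Ici 0) := hb_smooth.continuousOn
  have hNc : Continuous N := continuous_of_lipschitzOn_closedBall hNL
  have hfc := continuous_forcing hNc hbc
  set F := interactionField S (forcing N b)
  set y₀ : Energy n := WithLp.toLp 2 (u₀, u₁)
  have hFL : IsLocallyLipschitzField F :=
    isLocallyLipschitzField_interactionField hS (isLocallyLipschitzField_forcing hNL hbc)
  have hFc : ∀ y, Continuous fun t => F t y := fun y =>
    (continuous_interactionField hS hfc).comp (continuous_id.prodMk continuous_const)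
  have toODE : ∀ {T : EReal} {u : ℝ → H1 n}, IsStrongSolution p b u₀ u₁ T u →
      IsODESolution F y₀ T fun t => S (-t) (WithLp.toLp 2 (u t, velocity T u t)) := fun hu =>
    (hu.isWeakSolution hN).isODESolution hS (kleinGordonInverse_injective n) hfc
  have ofODE : ∀ {T : EReal} {Y : ℝ → Energy n}, 0 < T → IsODESolution F y₀ T Y →
      IsStrongSolution p b u₀ u₁ T fun t => (S t (Y t)).fst := fun hT hY =>
    (hY.isWeakSolution hS).isStrongSolution hN hNc hbc hT
  have huniq : ∀ (T : EReal) (u v : ℝ → H1 n), IsStrongSolution p b u₀ u₁ T u →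
      IsStrongSolution p b u₀ u₁ T v → EqOn u v (timeInterval T) := by
    intro T u v hu hv t ht
    have h1 := congrArg (S t) ((toODE hu).eqOn hFL (toODE hv) ht)
    simp only [hS.map_map_neg] at h1
    exact congrArg WithLp.fst h1
  -- The sets of existence times coincide, since solutions translate both ways without changing T.
  have hlife : lifespan p b u₀ u₁ = odeLifespan F y₀ := by
    refine congrArg sSup (Set.ext fun T => ⟨fun ⟨u, hu⟩ => ⟨hu.pos, _, toODE hu⟩, ?_⟩)
    rintro ⟨hT, Y, hY⟩
    exact ⟨_, ofODE hT hY⟩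
  obtain ⟨T, hT, Y, hY⟩ := exists_odeSolution hFL hFc y₀
  have hT' : (0 : EReal) < T := by exact_mod_cast hT
  have hpos : 0 < odeLifespan F y₀ := hT'.trans_le (le_sSup ⟨hT', Y, hY⟩)
  refine ⟨⟨T, hT, _, ofODE hT' hY, fun v hv => huniq _ _ _ hv (ofODE hT' hY)⟩, huniq, ?_⟩
  rw [hlife]
  obtain ⟨Z, hZ⟩ := exists_maximal_odeSolution hFL y₀ hpos
  refine ⟨_, ofODE hpos hZ, fun htop => ?_⟩
  -- The energy norm at t is ‖S(t) Z(t)‖ = ‖Z(t)‖, but only for t ≥ 0, hence the restriction to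
  -- times just before the lifespan.
  refine (hZ.tendsto_norm_atTop hFL hFc hpos htop).congr' ?_
  have hcoe : ((odeLifespan F y₀).toReal : EReal) = odeLifespan F y₀ :=
    EReal.coe_toReal htop.ne (ne_bot_of_gt hpos)
  have hpos' : 0 < (odeLifespan F y₀).toReal := by
    rw [← hcoe] at hpos
    exact_mod_cast hpos
  filter_upwards [Ioo_mem_nhdsLT hpos'] with t ht
  have htm : t ∈ timeInterval (odeLifespan F y₀) := by
    rw [← hcoe, mem_timeInterval_coe]
    exact ⟨ht.1.le, ht.2⟩
  rw [energyNorm_eq hNc hbc (hZ.isWeakSolution hS) htm, hS.norm_map]
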